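/- Quantum circuits are built from the gates CNOT (between any two distinct qubits, i.e. all-to-all connectivity), $T$, $T^\dagger$, $H=\frac1{\sqrt2}\begin{pmatrix}1&1\\1&-1\end{pmatrix}$, $R_x(\theta)=e^{-i\theta X/2}$ and $R_z(\theta)=e^{-i\theta Z/2}$ ($\theta\in\mathbb R$), where $T=\mathrm{diag}(1,e^{i\pi/4})$. A circuit is a sequence of time slots, each holding gates that act on pairwise disjoint sets of qubits. The cost of a kind of gate ($T$ and $T^\dagger$ both count as $T$ gates, $R_x$ and $R_z$ both as rotations) is the number of gates of this kind in the circuit, and its depth is the number of time slots holding at least one gate of this kind. For a set $C$ of qubits, $t\notin C$ and $A\in U(2)$, write $[A]_C^t$ for the gate that applies $A$ to $t$ when all qubits of $C$ are in state $|1\rangle$, and the identity otherwise. **Theorem.** Let $n\ge 6$ and $m\ge 1$, let $C$ be a set of $n$ control qubits, $t_1,\dots,t_m\notin C$ distinct target qubits, and $a$ one further (ancilla) qubit. Let $U_1,\dots,U_m\in U(2)$ and $G=\prod_{j=1}^m [U_j]_C^{t_j}$. 1. One can write $U_j=e^{i\psi_j}W_j$ with $\psi_j\in\mathbb R$ and $W_j\in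 SU(2)$ $(1\le j\le m)$, and for every such choice, with $\psi=\sum_j\psi_j$, one has $\big([R_z(-2\psi)]_C^{a}\prod_{j=1}^m[W_j]_C^{t_j}\big)(|\varphi\rangle\otimes|0\rangle_a)=(G|\varphi\rangle)\otimes|0\rangle_a$ for all states $|\varphi\rangle$ of the controls and targets. That is, with the ancilla in state $|0\rangle$, $G$ is a multi-controlled gate with $m+1$ $SU(2)$ targets. 2. There are a circuit $V$ on these $n+m+1$ qubits and $\omega\in\mathbb C$ with $|\omega|=1$ such that $V(|\varphi\rangle\otimes|0\rangle_a)=\omega\,(G|\varphi\rangle)\otimes|0\rangle_a$ for all $|\varphi\rangle$, and $V$ has - $8m+3$ rotations from $\{R_x,R_z\}$, - CNOT cost $12n-32+8m$ and depth $8n-8+8\lceil\log_2(m+1)\rceil$, - $T$ cost $16n-48$ and depth $8n-6$ for even $n$, $8n-3$ for odd $n$, - $H$ cost $8n-30$ and depth $4n-11$. These are the costs and depths of a multi-controlled multi-target $SU(2)$ gate with $n$ controls and $M=m+1$ targets, with five rotations replaced by two $H$ gates. For that $SU(2)$ gate they are: $8M$ rotations; CNOT cost $12n-32+8(M-1)$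 and depth $8n-8+8\lceil\log_2 M\rceil$; $T$ cost $16n-48$ and depth $8n-6$ ($8n-3$ for odd $n$); $H$ cost $8n-32$ and depth $4n-11$. -/

import Mathlib

open scoped Matrix

namespace QCircuit

noncomputable section

/-! ### Qubits, states and elementary matrices -/

/-- Computational basis states of a register whose qubits are labelled by `Q`. -/
abbrev Basis (Q : Type) := Q → Fin 2

/-- (Not necessarily normalised) pure states of the register `Q`, in the computational basis. -/
abbrev State (Q : Type) := Basis Q → ℂ

/-- Operators on the register `Q`, in the computational basis. -/
abbrev Op (Q : Type) := Matrix (Basis Q) (Basis Q) ℂ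

/-- The Pauli matrix `X`. -/
def pauliX : Matrix (Fin 2) (Fin 2) ℂ := !![0, 1; 1, 0]

/-- The Hadamard matrix `H`. -/
def hadamard : Matrix (Fin 2) (Fin 2) ℂ := ((Real.sqrt 2 : ℝ) : ℂ)⁻¹ • !![1, 1; 1, -1]

/-- The phase matrix `P(θ) = diag(1, e^{iθ})`. -/
def phase (θ : ℝ) : Matrix (Fin 2) (Fin 2) ℂ := !![1, 0; 0, Complex.exp (Complex.I * θ)]

/-- The rotation `R_x(θ) = exp(-iθX/2)`. -/
def rotX (θ : ℝ) : Matrix (Fin 2) (Fin 2) ℂ :=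
  !![(Real.cos (θ / 2) : ℂ), -Complex.I * (Real.sin (θ / 2) : ℂ);
     -Complex.I * (Real.sin (θ / 2) : ℂ), (Real.cos (θ / 2) : ℂ)]

/-- The rotation `R_z(θ) = exp(-iθZ/2) = diag(e^{-iθ/2}, e^{iθ/2})`. -/
def rotZ (θ : ℝ) : Matrix (Fin 2) (Fin 2) ℂ :=
  !![Complex.exp (-(Complex.I * (θ / 2))), 0; 0, Complex.exp (Complex.I * (θ / 2))]

/-- The multi-controlled gate `[A]_C^t`: the single-qubit operator `A` is applied to the qubit `t`
when all the qubits of `C` are in state `1`, and the identity otherwise (for `t ∉ C`). With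
`C = ∅` it is the operator `A` applied to the qubit `t`. -/
def controlled {Q : Type} [Fintype Q] [DecidableEq Q] (C : Finset Q)
    (A : Matrix (Fin 2) (Fin 2) ℂ) (t : Q) : Op Q :=
  Matrix.of fun x y =>
    if ∀ q, q ≠ t → x q = y q then
      (if ∀ c ∈ C, x c = 1 then A (x t) (y t) else (1 : Matrix (Fin 2) (Fin 2) ℂ) (x t) (y t))
    else 0

/-- The multi-controlled multi-target gate `∏ⱼ [Aⱼ]_C^{tⱼ}`. -/
def multiTarget {Q : Type} [Fintype Q] [DecidableEq Q] (C : Finset Q) {m : ℕ}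
    (A : Fin m → Matrix (Fin 2) (Fin 2) ℂ) (t : Fin m → Q) : Op Q :=
  (List.ofFn fun j => controlled C (A j) (t j)).prod

/-! ### Circuits -/

/-- The elementary gates: CNOT between any two distinct qubits (all-to-all connectivity),
the Clifford+T gates `T`, `T†`, `H`, and the rotations `R_x(θ)`, `R_z(θ)`. -/
inductive Gate (Q : Type) : Type
  | cnot (c t : Q) (h : c ≠ t) : Gate Q
  | T (q : Q) : Gate Q
  | Tdg (q : Q) : Gate Q
  | H (q : Q) : Gate Q
  | Rx (θ : ℝ) (q : Q) : Gate Q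
  | Rz (θ : ℝ) (q : Q) : Gate Q

/-- The kinds of gates that are counted; `T` and `T†` are both T gates. -/
inductive Kind : Type
  | cnot | t | h | rot
  deriving DecidableEq

/-- The kind of a gate. -/
def Gate.kind {Q : Type} : Gate Q → Kind
  | .cnot _ _ _ => .cnot
  | .T _ => .t
  | .Tdg _ => .t
  | .H _ => .h
  | .Rx _ _ => .rot
  | .Rz _ _ => .rot

/-- The qubits on which a gate acts. -/
def Gate.support {Q : Type} [DecidableEq Q] : Gate Q → Finset Q
  | .cnot c t _ => {c, t}
  | .T q => {q}
  | .Tdg q => {q}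
  | .H q => {q}
  | .Rx _ q => {q}
  | .Rz _ q => {q}

/-- The operator of a gate. -/
def Gate.op {Q : Type} [Fintype Q] [DecidableEq Q] : Gate Q → Op Q
  | .cnot c t _ => controlled {c} pauliX t
  | .T q => controlled ∅ (phase (Real.pi / 4)) q
  | .Tdg q => controlled ∅ (phase (-(Real.pi / 4))) q
  | .H q => controlled ∅ hadamard q
  | .Rx θ q => controlled ∅ (rotX θ) q
  | .Rz θ q => controlled ∅ (rotZ θ) q

/-- A circuit: a sequence of time slots, in order of execution; the gates in one time slot are
executed in parallel, hence act on pairwise disjoint sets of qubits. -/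
structure Circuit (Q : Type) [DecidableEq Q] where
  slots : List (List (Gate Q))
  disjoint : ∀ L ∈ slots, L.Pairwise fun g g' => Disjoint g.support g'.support

namespace Circuit

/-- The operator of a circuit (the gates executed first are the rightmost factors). -/
def op {Q : Type} [Fintype Q] [DecidableEq Q] (V : Circuit Q) : Op Q :=
  (V.slots.flatten.map Gate.op).reverse.prod

/-- The cost: the number of gates of a given kind. -/
def cost {Q : Type} [DecidableEq Q] (V : Circuit Q) (k : Kind) : ℕ :=
  V.slots.flatten.countP fun g => decide (g.kind = k)

/-- The depth: the number of time slots that hold at least one gate of a given kind. -/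
def depth {Q : Type} [DecidableEq Q] (V : Circuit Q) (k : Kind) : ℕ :=
  V.slots.countP fun L => L.any fun g => decide (g.kind = k)

end Circuit

/-- The costs and depths that are recorded for an implementation. -/
@[ext]
structure Resources where
  rotCost : ℕ
  cnotCost : ℕ
  cnotDepth : ℕ
  tCost : ℕ
  tDepth : ℕ
  hCost : ℕ
  hDepth : ℕ

/-- The costs and depths of a circuit, all read off from the same sequence of time slots. -/
def Circuit.resources {Q : Type} [DecidableEq Q] (V : Circuit Q) : Resources where
  rotCost := V.cost .rot
  cnotCost := V.cost .cnot
  cnotDepth := V.depth .cnot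
  tCost := V.cost .t
  tDepth := V.depth .t
  hCost := V.cost .h
  hDepth := V.depth .h

/-- The costs and depths of the multi-controlled `SU(2)` gate with `n ≥ 6` controls. -/
def mcsu2Resources (n : ℕ) : Resources where
  rotCost := 8
  cnotCost := 12 * n - 32
  cnotDepth := 8 * n - 8
  tCost := 16 * n - 48
  tDepth := if Even n then 8 * n - 6 else 8 * n - 3
  hCost := 8 * n - 32
  hDepth := 4 * n - 11

/-- The costs and depths of the multi-controlled multi-target `SU(2)` gate with `n ≥ 6` controls
and `m ≥ 1` targets: the rotation and CNOT costs of the single-target gate increase by `8(m-1)`,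
and its CNOT depth by `8⌈log₂ m⌉`. -/
def mcmtsu2Resources (n m : ℕ) : Resources :=
  { mcsu2Resources n with
    rotCost := (mcsu2Resources n).rotCost + 8 * (m - 1)
    cnotCost := (mcsu2Resources n).cnotCost + 8 * (m - 1)
    cnotDepth := (mcsu2Resources n).cnotDepth + 8 * Nat.clog 2 m }

/-- The costs and depths of the multi-controlled multi-target `SU(2)` gate with `m + 1` targets,
with five rotations replaced by two Hadamard gates. -/
def mcmtu2Resources (n m : ℕ) : Resources :=
  { mcmtsu2Resources n (m + 1) with
    rotCost := (mcmtsu2Resources n (m + 1)).rotCost - 5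
    hCost := (mcmtsu2Resources n (m + 1)).hCost + 2 }

/-! ### The register -/

/-- The register without ancilla: `n` controls and `m` targets. -/
abbrev DataReg (n m : ℕ) := Fin n ⊕ Fin m

/-- The register with one ancilla qubit. -/
abbrev FullReg (n m : ℕ) := DataReg n m ⊕ Unit

/-- The control qubits in the register without ancilla. -/
def dataControls (n m : ℕ) : Finset (DataReg n m) :=
  Finset.univ.image fun i : Fin n => Sum.inl i

/-- The control qubits in the register with ancilla. -/
def fullControls (n m : ℕ) : Finset (FullReg n m) :=
  Finset.univ.image fun i : Fin n => Sum.inl (Sum.inl i)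

/-- The ancilla qubit. -/
def ancilla (n m : ℕ) : FullReg n m := Sum.inr ()

/-- The state `φ ⊗ |0⟩`, with the ancilla qubit in state `|0⟩`. -/
def withAncilla {n m : ℕ} (φ : State (DataReg n m)) : State (FullReg n m) :=
  fun x => if x (ancilla n m) = 0 then φ (fun q => x (Sum.inl q)) else 0

end

end QCircuit

open QCircuit

/-!
A unitary is a phase times an element of `SU(2)`, and a controlled phase is a controlled `Z` rotation
of a qubit in state `0`. So the gate is a multi-controlled gate with `m + 1` targets in `SU(2)`, one
of which is the ancilla qubit (`controlled_ancilla_mul_multiTarget_mulVec`). It remains to implement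
such a gate with few gates.

*Commutator.* Every element of `SU(2)` is conjugate to a rotation about the `x`-axis by a product of
an `x`- and a `z`-rotation (`exists_axis_angle`); for the rotation of the ancilla qubit a Hadamard
gate does. An `x`-rotation controlled by the conjunction of two conditions `P₁` and `P₂` is the group
commutator of Pauli `Z` matrices controlled by `P₁` and by `P₂`, interleaved with four rotations
`R_x(±φ)` (`commutator_rotX`). On the ancilla qubit the first of these is omitted. In the Hadamard
frame it would be a `z`-rotation, which multiplies the state `0` by a phase: the global phase `ω`.

*Conditions.* `P₁` says that the first two controls are in state `1`, and is evaluated by a doubly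
controlled phase gate with four `T` gates (`parity_phases`). Where `P₁` holds, these two controls are
known to be in state `1`, and so can serve as work qubits. A ladder of `n - 4` relative-phase Toffoli
gates then reduces the conjunction of the other controls to a condition on two qubits (`ladder_act`):
each rung writes onto a qubit that is in state `1` if the conjunctions of the rungs before it are
true. `P₂` is the condition on these two qubits after the ladder. Where `P₁` fails, the value of
`P₂` does not matter, since the commutator is trivial.
A relative-phase Toffoli gate permutes the basis states only up to phases, but the ladder occurs only
in conjugations of diagonal operators, where the phases cancel (`IsMonomial.conj_diagonal`). All
relative phases on the ancilla and target qubits cancel in the commutator as well.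

*Several targets.* The product of the `Z` matrices on all targets and the ancilla qubit is `Z` on a
single qubit that holds their parity. The parity is collected by a tree of `m` CNOT gates of depth
`⌈log₂ (m + 1)⌉` (`fanSlots_isMonomial`).

*Depths.* Consecutive rungs of a ladder overlap: the second half of one is run in parallel to the
first half of the next (`gatesOp_ladderSlots`). The costs and the Hadamard depth come out as stated,
and the other depths do not exceed the stated ones. Since a time slot with several gates can be
split, they can be raised to the stated values (`exists_slots_depth_eq`).
-/

namespace QCircuit

set_option linter.unusedSectionVars false

noncomputable section

variable {Q : Type}

/-! ### Multiplexed single-qubit operators -/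

/-- `F` does not depend on the value of the qubit `t`. -/
def IndepOf [DecidableEq Q] {α : Type*} (F : Basis Q → α) (t : Q) : Prop :=
  ∀ x b, F (Function.update x t b) = F x

theorem IndepOf.eq_of_agree [DecidableEq Q] {α : Type*} {F : Basis Q → α} {t : Q}
    (hF : IndepOf F t) {x y : Basis Q} (h : ∀ q, q ≠ t → x q = y q) : F x = F y := by
  have : y = Function.update x t (y t) := by
    funext q
    by_cases hq : q = t
    · subst hq; simp
    · simp [hq, h q hq]
  rw [this, hF]

theorem IndepOf.comp [DecidableEq Q] {α β : Type*} {F : Basis Q → α} {t : Q}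
    (hF : IndepOf F t) (g : α → β) : IndepOf (fun x => g (F x)) t :=
  fun x b => congrArg g (hF x b)

theorem IndepOf.comp₂ [DecidableEq Q] {α β γ : Type*} {F : Basis Q → α} {G : Basis Q → β} {t : Q}
    (hF : IndepOf F t) (hG : IndepOf G t) (g : α → β → γ) : IndepOf (fun x => g (F x) (G x)) t :=
  fun x b => by simp only [hF x b, hG x b]

theorem indepOf_const [DecidableEq Q] {α : Type*} (a : α) (t : Q) :
    IndepOf (fun _ : Basis Q => a) t := fun _ _ => rfl

theorem indepOf_eval [DecidableEq Q] {c t : Q} (h : c ≠ t) :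
    IndepOf (fun x : Basis Q => x c) t := fun x b => by simp [h]

variable [Fintype Q] [DecidableEq Q]

/-- The multiplexed operator: the qubit `t` undergoes the `2 × 2` matrix `F x`, selected by the
computational basis state `x`. It is meant for `F` that do not depend on the qubit `t`. -/
def muxOp (F : Basis Q → Matrix (Fin 2) (Fin 2) ℂ) (t : Q) : Op Q :=
  Matrix.of fun x y => if ∀ q, q ≠ t → x q = y q then F x (x t) (y t) else 0

theorem muxOp_apply (F : Basis Q → Matrix (Fin 2) (Fin 2) ℂ) (t : Q) (x y : Basis Q) :
    muxOp F t x y = if ∀ q, q ≠ t → x q = y q then F x (x t) (y t) else 0 := rfl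

theorem controlled_eq_muxOp (C : Finset Q) (A : Matrix (Fin 2) (Fin 2) ℂ) (t : Q) :
    controlled C A t = muxOp (fun x => if ∀ c ∈ C, x c = 1 then A else 1) t := by
  ext x y
  simp only [controlled, muxOp_apply, Matrix.of_apply]
  split_ifs <;> rfl

theorem controlled_empty (A : Matrix (Fin 2) (Fin 2) ℂ) (t : Q) :
    controlled ∅ A t = muxOp (fun _ => A) t := by
  simp [controlled_eq_muxOp]

/-- Each row of a multiplexed operator has at most two nonzero entries. -/
theorem sum_muxOp_mul (F : Basis Q → Matrix (Fin 2) (Fin 2) ℂ) (t : Q) (x : Basis Q)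
    (g : Basis Q → ℂ) :
    ∑ z, muxOp F t x z * g z = ∑ b, F x (x t) b * g (Function.update x t b) := by
  symm
  apply Fintype.sum_of_injective (fun b => Function.update x t b)
    (Function.update_injective x t)
  · intro z hz
    rw [muxOp_apply, if_neg, zero_mul]
    intro h
    apply hz
    refine ⟨z t, ?_⟩
    funext q
    by_cases hq : q = t
    · subst hq; simp
    · simp [hq, h q hq]
  · intro b
    rw [muxOp_apply, if_pos]
    · simp
    · intro q hq; simp [hq]

theorem muxOp_mulVec (F : Basis Q → Matrix (Fin 2) (Fin 2) ℂ) (t : Q) (φ : State Q)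
    (x : Basis Q) :
    (muxOp F t).mulVec φ x = ∑ b, F x (x t) b * φ (Function.update x t b) :=
  sum_muxOp_mul F t x φ

theorem muxOp_mul_muxOp {F G : Basis Q → Matrix (Fin 2) (Fin 2) ℂ} {t : Q} (hG : IndepOf G t) :
    muxOp F t * muxOp G t = muxOp (fun x => F x * G x) t := by
  ext x y
  rw [Matrix.mul_apply, sum_muxOp_mul, muxOp_apply]
  simp only [muxOp_apply, hG x, Function.update_self, Matrix.mul_apply]
  by_cases h : ∀ q, q ≠ t → x q = y q
  · rw [if_pos h]
    refine Finset.sum_congr rfl fun b _ => ?_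
    rw [if_pos]
    intro q hq; simp [hq, h q hq]
  · rw [if_neg h]
    refine Finset.sum_eq_zero fun b _ => ?_
    rw [if_neg, mul_zero]
    intro h'; apply h
    intro q hq
    simpa [hq] using h' q hq

theorem muxOp_mul_apply_of_ne {F G : Basis Q → Matrix (Fin 2) (Fin 2) ℂ} {t s : Q} (hts : t ≠ s)
    (hG : IndepOf G t) (x y : Basis Q) :
    (muxOp F t * muxOp G s) x y =
      if ∀ q, q ≠ t → q ≠ s → x q = y q then F x (x t) (y t) * G x (x s) (y s) else 0 := by
  rw [Matrix.mul_apply, sum_muxOp_mul]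
  simp only [muxOp_apply, hG x, Function.update_of_ne hts.symm]
  rw [Finset.sum_eq_single (y t)]
  · have : (∀ q, q ≠ s → Function.update x t (y t) q = y q) ↔
        ∀ q, q ≠ t → q ≠ s → x q = y q := by
      constructor
      · intro h q hq hq'; simpa [hq] using h q hq'
      · intro h q hq
        by_cases hqt : q = t
        · subst hqt; simp
        · simp [hqt, h q hqt hq]
    simp only [this]
    split_ifs <;> simp
  · intro b _ hb
    rw [if_neg, mul_zero]
    intro h
    apply hb
    simpa using h t hts
  · simp

theorem muxOp_commute {F G : Basis Q → Matrix (Fin 2) (Fin 2) ℂ} {t s : Q} (hts : t ≠ s)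
    (hF : IndepOf F s) (hG : IndepOf G t) : Commute (muxOp F t) (muxOp G s) := by
  ext x y
  rw [muxOp_mul_apply_of_ne hts hG, muxOp_mul_apply_of_ne hts.symm hF]
  have : (∀ q, q ≠ t → q ≠ s → x q = y q) ↔ (∀ q, q ≠ s → q ≠ t → x q = y q) :=
    forall_congr' fun q => by tauto
  simp only [this, mul_comm]

theorem muxOp_diagonal (g : Basis Q → Fin 2 → ℂ) (t : Q) :
    muxOp (fun x => Matrix.diagonal (g x)) t = Matrix.diagonal fun x => g x (x t) := by
  ext x y
  rw [muxOp_apply]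
  by_cases h : x = y
  · subst h; simp [Matrix.diagonal_apply_eq]
  · rw [Matrix.diagonal_apply_ne _ h]
    split_ifs with h'
    · apply Matrix.diagonal_apply_ne
      intro ht
      apply h
      funext q
      by_cases hq : q = t
      · subst hq; exact ht
      · exact h' q hq
    · rfl

theorem muxOp_one (t : Q) : muxOp (fun _ : Basis Q => 1) t = 1 := by
  have := muxOp_diagonal (fun (_ : Basis Q) _ => (1 : ℂ)) t
  simpa using this

/-! ### Gate sequences and their inverses -/

/-- Every gate is a multiplexed operator on one of the qubits of its support. -/
theorem Gate.exists_op_eq_muxOp (g : Gate Q) : ∃ F t, g.op = muxOp F t ∧ t ∈ g.support ∧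
    ∀ s ∉ g.support, IndepOf F s := by
  cases g with
  | cnot c t h =>
    refine ⟨_, t, controlled_eq_muxOp _ _ _, by simp [Gate.support], ?_⟩
    intro s hs x b
    have : c ≠ s := by rintro rfl; simp [Gate.support] at hs
    simp [this]
  | T q => exact ⟨_, q, controlled_empty _ _, by simp [Gate.support], fun s _ => indepOf_const _ s⟩
  | Tdg q => exact ⟨_, q, controlled_empty _ _, by simp [Gate.support], fun s _ => indepOf_const _ s⟩
  | H q => exact ⟨_, q, controlled_empty _ _, by simp [Gate.support], fun s _ => indepOf_const _ s⟩
  | Rx θ q =>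
    exact ⟨_, q, controlled_empty _ _, by simp [Gate.support], fun s _ => indepOf_const _ s⟩
  | Rz θ q =>
    exact ⟨_, q, controlled_empty _ _, by simp [Gate.support], fun s _ => indepOf_const _ s⟩

theorem Gate.op_commute {g g' : Gate Q} (h : Disjoint g.support g'.support) :
    Commute g.op g'.op := by
  obtain ⟨F, t, hF, ht, hF'⟩ := g.exists_op_eq_muxOp
  obtain ⟨G, s, hG, hs, hG'⟩ := g'.exists_op_eq_muxOp
  rw [hF, hG]
  refine muxOp_commute ?_ (hF' s (Finset.disjoint_right.1 h hs))
    (hG' t (Finset.disjoint_left.1 h ht))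
  rintro rfl
  exact Finset.disjoint_left.1 h ht hs

/-- The operator of a sequence of gates, executed from left to right. -/
def gatesOp (l : List (Gate Q)) : Op Q := (l.map Gate.op).reverse.prod

@[simp] theorem gatesOp_nil : gatesOp ([] : List (Gate Q)) = 1 := by simp [gatesOp]

theorem gatesOp_cons (g : Gate Q) (l : List (Gate Q)) : gatesOp (g :: l) = gatesOp l * g.op := by
  simp [gatesOp]

theorem gatesOp_append (l l' : List (Gate Q)) : gatesOp (l ++ l') = gatesOp l' * gatesOp l := by
  simp [gatesOp]

theorem gatesOp_singleton (g : Gate Q) : gatesOp [g] = g.op := by simp [gatesOp]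

theorem gatesOp_commute {l l' : List (Gate Q)}
    (h : ∀ g ∈ l, ∀ g' ∈ l', Disjoint g.support g'.support) :
    Commute (gatesOp l) (gatesOp l') := by
  refine Commute.list_prod_left _ _ fun a ha => Commute.list_prod_right _ _ fun b hb => ?_
  simp only [List.mem_reverse, List.mem_map] at ha hb
  obtain ⟨g, hg, rfl⟩ := ha
  obtain ⟨g', hg', rfl⟩ := hb
  exact Gate.op_commute (h g hg g' hg')

/-- The inverse gate. -/
def Gate.inv {Q : Type} : Gate Q → Gate Q
  | .cnot c t h => .cnot c t h
  | .T q => .Tdg q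
  | .Tdg q => .T q
  | .H q => .H q
  | .Rx θ q => .Rx (-θ) q
  | .Rz θ q => .Rz (-θ) q

@[simp] theorem Gate.support_inv {Q : Type} [DecidableEq Q] (g : Gate Q) :
    g.inv.support = g.support := by
  cases g <;> rfl

@[simp] theorem Gate.kind_inv {Q : Type} (g : Gate Q) : g.inv.kind = g.kind := by cases g <;> rfl

theorem pauliX_mul_self : pauliX * pauliX = 1 := by
  simp [pauliX, Matrix.one_fin_two]

theorem hadamard_mul_self : hadamard * hadamard = 1 := by
  have h : ((Real.sqrt 2 : ℝ) : ℂ) * ((Real.sqrt 2 : ℝ) : ℂ) = 2 := by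
    rw [← Complex.ofReal_mul, Real.mul_self_sqrt (by norm_num)]; norm_num
  have h' : ((Real.sqrt 2 : ℝ) : ℂ)⁻¹ * ((Real.sqrt 2 : ℝ) : ℂ)⁻¹ = 2⁻¹ := by
    rw [← mul_inv, h]
  rw [hadamard, Matrix.smul_mul, Matrix.mul_smul, smul_smul, h']
  ext i j
  fin_cases i <;> fin_cases j <;> norm_num [Matrix.mul_apply, Fin.sum_univ_two]

theorem phase_mul (θ θ' : ℝ) : phase θ * phase θ' = phase (θ + θ') := by
  simp [phase, ← Complex.exp_add, mul_add]

theorem phase_zero : phase 0 = 1 := by simp [phase, Matrix.one_fin_two]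

theorem rotX_mul (θ θ' : ℝ) : rotX θ * rotX θ' = rotX (θ + θ') := by
  ext i j
  fin_cases i <;> fin_cases j <;>
    simp [rotX, Matrix.mul_apply, Fin.sum_univ_two, add_div, Complex.cos_add, Complex.sin_add] <;>
    first
    | ring1
    | linear_combination (Complex.sin (θ / 2) * Complex.sin (θ' / 2)) * Complex.I_mul_I

theorem rotX_zero : rotX 0 = 1 := by simp [rotX, Matrix.one_fin_two]

theorem rotZ_mul (θ θ' : ℝ) : rotZ θ * rotZ θ' = rotZ (θ + θ') := by
  simp [rotZ, ← Complex.exp_add]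
  constructor <;> congr 1 <;> ring

theorem rotZ_zero : rotZ 0 = 1 := by simp [rotZ, Matrix.one_fin_two]

theorem Gate.inv_op_mul_op (g : Gate Q) : g.inv.op * g.op = 1 := by
  cases g with
  | cnot c t h =>
    simp only [Gate.inv, Gate.op, controlled_eq_muxOp]
    rw [muxOp_mul_muxOp]
    · convert muxOp_one t using 2
      funext x
      split_ifs <;> simp [pauliX_mul_self]
    · intro x b; simp [h]
  | T q =>
    simp only [Gate.inv, Gate.op, controlled_empty]
    rw [muxOp_mul_muxOp (indepOf_const _ _), phase_mul, neg_add_cancel, phase_zero, muxOp_one]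
  | Tdg q =>
    simp only [Gate.inv, Gate.op, controlled_empty]
    rw [muxOp_mul_muxOp (indepOf_const _ _), phase_mul, add_neg_cancel, phase_zero, muxOp_one]
  | H q =>
    simp only [Gate.inv, Gate.op, controlled_empty]
    rw [muxOp_mul_muxOp (indepOf_const _ _), hadamard_mul_self, muxOp_one]
  | Rx θ q =>
    simp only [Gate.inv, Gate.op, controlled_empty]
    rw [muxOp_mul_muxOp (indepOf_const _ _), rotX_mul, neg_add_cancel, rotX_zero, muxOp_one]
  | Rz θ q =>
    simp only [Gate.inv, Gate.op, controlled_empty]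
    rw [muxOp_mul_muxOp (indepOf_const _ _), rotZ_mul, neg_add_cancel, rotZ_zero, muxOp_one]

/-- The inverse of a gate sequence. -/
def invGates {Q : Type} (l : List (Gate Q)) : List (Gate Q) := (l.map Gate.inv).reverse

theorem gatesOp_invGates_mul (l : List (Gate Q)) : gatesOp (invGates l) * gatesOp l = 1 := by
  induction l with
  | nil => simp [invGates]
  | cons g l ih =>
    have : invGates (g :: l) = invGates l ++ [g.inv] := by simp [invGates]
    rw [this, gatesOp_append, gatesOp_singleton, gatesOp_cons, mul_assoc,
      ← mul_assoc _ _ g.op, ih, one_mul, g.inv_op_mul_op]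

/-! ### Monomial operators -/

/-- The operator `R` maps every computational basis state `y` to a multiple of the basis state
`π y`. -/
def IsMonomial (R : Op Q) (π : Basis Q → Basis Q) : Prop := ∀ x y, R x y ≠ 0 → x = π y

theorem IsMonomial.mul {R S : Op Q} {π ρ : Basis Q → Basis Q} (hR : IsMonomial R π)
    (hS : IsMonomial S ρ) : IsMonomial (R * S) (π ∘ ρ) := by
  intro x y h
  rw [Matrix.mul_apply] at h
  obtain ⟨z, -, hz⟩ := Finset.exists_ne_zero_of_sum_ne_zero h
  rw [hR x z (left_ne_zero_of_mul hz), hS z y (right_ne_zero_of_mul hz)]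
  rfl

theorem isMonomial_one : IsMonomial (1 : Op Q) id := by
  intro x y h
  by_contra h'
  exact h (Matrix.one_apply_ne h')

/-- Conjugating a diagonal operator by a monomial one permutes its entries. -/
theorem IsMonomial.conj_diagonal {R R' : Op Q} {π : Basis Q → Basis Q} (hR : IsMonomial R π)
    (h : R' * R = 1) (e : Basis Q → ℂ) :
    R' * Matrix.diagonal e * R = Matrix.diagonal (e ∘ π) := by
  have : Matrix.diagonal e * R = R * Matrix.diagonal (e ∘ π) := by
    ext x y
    rw [Matrix.diagonal_mul, Matrix.mul_diagonal]
    by_cases hxy : R x y = 0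
    · simp [hxy]
    · rw [hR x y hxy, mul_comm]; rfl
  rw [mul_assoc, this, ← mul_assoc, h, one_mul]

/-- A multiplexed operator whose matrices are antidiagonal where `p` holds, and diagonal elsewhere,
is a controlled bit flip up to phases. -/
theorem isMonomial_muxOp {F : Basis Q → Matrix (Fin 2) (Fin 2) ℂ} {t : Q} {p : Basis Q → Prop}
    [DecidablePred p] (hp : IndepOf p t)
    (h : ∀ x i j, F x i j ≠ 0 → i = if p x then j + 1 else j) :
    IsMonomial (muxOp F t) fun x => if p x then Function.update x t (x t + 1) else x := by
  intro x y hxy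
  rw [muxOp_apply] at hxy
  split_ifs at hxy with h'
  · have h1 := h _ _ _ hxy
    have hpe : p x = p y := hp.eq_of_agree h'
    simp only [hpe] at h1
    funext q
    by_cases hq : q = t
    · subst hq
      by_cases hy : p y <;> simp [hy] at h1 ⊢ <;> exact h1
    · by_cases hy : p y <;> simp [hy, hq, h' q hq]
  · exact absurd rfl hxy

end

noncomputable section

variable {Q : Type} [Fintype Q] [DecidableEq Q]

/-! ### Relative-phase Toffoli gates -/

/-- The Pauli matrix `Z`. -/
def pauliZ : Matrix (Fin 2) (Fin 2) ℂ := !![1, 0; 0, -1]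

/-- The CNOT gate with control `c` and target `t`; the value for `c = t` is irrelevant. -/
def cx {Q : Type} [DecidableEq Q] (c t : Q) : Gate Q := if h : c ≠ t then .cnot c t h else .T t

/-- The gate `T` if `b` is true, and `T†` otherwise. -/
def tGate {Q : Type} (b : Bool) (q : Q) : Gate Q := if b then .T q else .Tdg q

/-- `X` to the power of a bit. -/
def xPow (b : Fin 2) : Matrix (Fin 2) (Fin 2) ℂ := if b = 1 then pauliX else 1

/-- The matrix of `T` if `b` is true, and of `T†` otherwise. -/
def tMat (b : Bool) : Matrix (Fin 2) (Fin 2) ℂ :=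
  phase (if b then Real.pi / 4 else -(Real.pi / 4))

theorem op_cx {c t : Q} (h : c ≠ t) : (cx c t).op = muxOp (fun x => xPow (x c)) t := by
  simp [cx, h, Gate.op, controlled_eq_muxOp, xPow]

theorem op_tGate (b : Bool) (q : Q) : (tGate b q).op = muxOp (fun _ => tMat b) q := by
  cases b <;> simp [tGate, Gate.op, controlled_empty, tMat]

theorem op_H (q : Q) : (Gate.H q).op = muxOp (fun _ => hadamard) q := controlled_empty _ _

/-- The phase that a doubly controlled phase gate with polarities `ps` and `pm` applies when it is
not active. -/
def idlePhase (ps pm : Fin 2) : ℂ := if ps = 0 ∧ pm = 0 then Complex.I else 1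

theorem idlePhase_ne_zero (ps pm : Fin 2) : idlePhase ps pm ≠ 0 := by
  rw [idlePhase]; split_ifs <;> simp

/-- The matrix of a doubly controlled phase gate with polarities `ps` and `pm`, for the values `a`
and `b` of its controls: up to phase, it is `Z` if `a = ps` and `b = pm`, and the identity
otherwise. -/
def ccMat (ps pm a b : Fin 2) : Matrix (Fin 2) (Fin 2) ℂ :=
  if a = ps ∧ b = pm then (-Complex.I * idlePhase ps pm) • pauliZ else idlePhase ps pm • 1

/-- Four `T` or `T†` gates on the parities `t`, `t ⊕ a`, `t ⊕ a ⊕ b`, `t ⊕ b` of the target qubit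
`t` with the control values `a`, `b`. For `ps = pm = 1` they multiply, up to a phase independent of
`t`, to `(-1)^t` if `a = b = 1`, and to `1` otherwise, because of
`4ab = 1 - (-1)^a - (-1)^b + (-1)^(a+b)`. The other polarities amount to sign changes of `(-1)^a` and
`(-1)^b`. -/
theorem parity_phases (ps pm a b : Fin 2) :
    tMat (pm = 0) * xPow a * tMat (ps = pm) * xPow b * tMat (ps = 0) * xPow a * tMat true =
      xPow b * ccMat ps pm a b := by
  -- with `w = exp(iπ/4)`, the sixteen cases are identities between polynomials modulo `w ^ 4 = -1`
  obtain ⟨w, hT, hTdg, hI, hw⟩ : ∃ w : ℂ, phase (Real.pi / 4) = !![1, 0; 0, w] ∧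
      phase (-(Real.pi / 4)) = !![1, 0; 0, -w ^ 3] ∧ Complex.I = w ^ 2 ∧ w ^ 4 = -1 := by
    have h2 : Complex.exp (Complex.I * (Real.pi / 4)) ^ 2 = Complex.I := by
      rw [← Complex.exp_nat_mul]
      convert Complex.exp_pi_div_two_mul_I using 2
      push_cast; ring
    have h1 : Complex.exp (Complex.I * (Real.pi / 4)) * Complex.exp (-(Complex.I * (Real.pi / 4)))
        = 1 := by
      rw [← Complex.exp_add, add_neg_cancel, Complex.exp_zero]
    refine ⟨Complex.exp (Complex.I * (Real.pi / 4)), by simp [phase], ?_, h2.symm, ?_⟩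
    · have h4 : Complex.exp (-(Complex.I * (Real.pi / 4))) =
          -Complex.exp (Complex.I * (Real.pi / 4)) ^ 3 := by
        have h3 := Complex.I_sq
        rw [← h2] at h3
        linear_combination Complex.exp (-(Complex.I * (Real.pi / 4))) * h3 -
          Complex.exp (Complex.I * (Real.pi / 4)) ^ 3 * h1
      simp [phase, h4]
    · calc _ = (Complex.exp (Complex.I * (Real.pi / 4)) ^ 2) ^ 2 := by ring
        _ = -1 := by rw [h2, Complex.I_sq]
  fin_cases ps <;> fin_cases pm <;> fin_cases a <;> fin_cases b <;>
    simp [tMat, xPow, ccMat, idlePhase, hT, hTdg, hI, pauliX, pauliZ, Matrix.one_fin_two] <;>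
    grind

/-- The gates of a doubly controlled phase gate on the qubit `t`, with controls `s` and `m` and
polarities `ps` and `pm`, followed by a CNOT from `m` to `t`. -/
def ccGates {Q : Type} [DecidableEq Q] (s m : Q) (ps pm : Fin 2) (t : Q) : List (Gate Q) :=
  [tGate true t, cx s t, tGate (ps = 0) t, cx m t, tGate (ps = pm) t, cx s t, tGate (pm = 0) t]

theorem gatesOp_ccGates {s m t : Q} (hs : s ≠ t) (hm : m ≠ t) (ps pm : Fin 2) :
    gatesOp (ccGates s m ps pm t) =
      muxOp (fun x => xPow (x m) * ccMat ps pm (x s) (x m)) t := by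
  have is : IndepOf (fun x : Basis Q => x s) t := indepOf_eval hs
  have im : IndepOf (fun x : Basis Q => x m) t := indepOf_eval hm
  have ht : ∀ b, IndepOf (fun _ : Basis Q => tMat b) t := fun b => indepOf_const _ t
  simp only [ccGates, gatesOp_cons, gatesOp_nil, one_mul, op_tGate, op_cx hs, op_cx hm]
  rw [muxOp_mul_muxOp (is.comp _), muxOp_mul_muxOp (ht _), muxOp_mul_muxOp (im.comp _),
    muxOp_mul_muxOp (ht _), muxOp_mul_muxOp (is.comp _), muxOp_mul_muxOp (ht _)]
  simp only [parity_phases]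

theorem xPow_mul_self (b : Fin 2) : xPow b * xPow b = 1 := by
  rw [xPow]; split_ifs <;> simp [pauliX_mul_self]

/-- The doubly controlled phase gate, as a diagonal operator. -/
theorem gatesOp_ccGates_cx {s m t : Q} (hs : s ≠ t) (hm : m ≠ t) (ps pm : Fin 2) :
    gatesOp (ccGates s m ps pm t ++ [cx m t]) =
      muxOp (fun x => ccMat ps pm (x s) (x m)) t := by
  have is : IndepOf (fun x : Basis Q => x s) t := indepOf_eval hs
  have im : IndepOf (fun x : Basis Q => x m) t := indepOf_eval hm
  rw [gatesOp_append, gatesOp_singleton, gatesOp_ccGates hs hm, op_cx hm, muxOp_mul_muxOp]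
  · simp only [← mul_assoc, xPow_mul_self, one_mul]
  · intro x b
    simp [hs, hm]

/-- A relative-phase Toffoli gate: the qubit `tgt` is flipped if `side` has the value `ps` and
`mid` has the value `pm`. -/
structure Rung (Q : Type) where
  tgt : Q
  mid : Q
  side : Q
  ps : Fin 2
  pm : Fin 2

/-- The gates of a relative-phase Toffoli gate. -/
def Rung.gates (ρ : Rung Q) : List (Gate Q) :=
  .H ρ.tgt :: (ccGates ρ.side ρ.mid ρ.ps ρ.pm ρ.tgt ++ [.H ρ.tgt])

/-- The three qubits of a relative-phase Toffoli gate are distinct. -/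
def Rung.Valid (ρ : Rung Q) : Prop := ρ.mid ≠ ρ.tgt ∧ ρ.side ≠ ρ.tgt ∧ ρ.mid ≠ ρ.side

/-- The action of a relative-phase Toffoli gate on computational basis states, up to phases. -/
def Rung.act (ρ : Rung Q) (x : Basis Q) : Basis Q :=
  if x ρ.side = ρ.ps ∧ x ρ.mid = ρ.pm then Function.update x ρ.tgt (x ρ.tgt + 1) else x

/-- Conjugated by Hadamard gates, the phase gate is diagonal or antidiagonal; the factor `xPow b`,
which stands for an omitted CNOT gate, becomes a sign. -/
theorem hadamard_conj_entry (ps pm a b i j : Fin 2)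
    (h : (hadamard * (xPow b * ccMat ps pm a b) * hadamard) i j ≠ 0) :
    i = if a = ps ∧ b = pm then j + 1 else j := by
  contrapose! h
  unfold ccMat at *
  split_ifs at h ⊢ <;> fin_cases i <;> fin_cases j <;> simp at h <;> fin_cases b <;>
    simp [hadamard, xPow, pauliX, pauliZ, Matrix.mul_apply, Fin.sum_univ_two]

theorem Rung.isMonomial {ρ : Rung Q} (h : ρ.Valid) : IsMonomial (gatesOp ρ.gates) ρ.act := by
  have is : IndepOf (fun x : Basis Q => x ρ.side) ρ.tgt := indepOf_eval h.2.1
  have im : IndepOf (fun x : Basis Q => x ρ.mid) ρ.tgt := indepOf_eval h.1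
  have : gatesOp ρ.gates = muxOp (fun x => hadamard *
      (xPow (x ρ.mid) * ccMat ρ.ps ρ.pm (x ρ.side) (x ρ.mid)) * hadamard) ρ.tgt := by
    rw [Rung.gates, gatesOp_cons, gatesOp_append, gatesOp_singleton, gatesOp_ccGates h.2.1 h.1,
      op_H, muxOp_mul_muxOp, muxOp_mul_muxOp (indepOf_const _ _)]
    intro x b
    simp [h.1, h.2.1]
  rw [this]
  refine isMonomial_muxOp (p := fun x => x ρ.side = ρ.ps ∧ x ρ.mid = ρ.pm) ?_ ?_
  · intro x b
    simp [h.1, h.2.1]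
  · intro x i j hij
    exact hadamard_conj_entry _ _ _ _ _ _ hij

end

noncomputable section

variable {Q : Type} [DecidableEq Q]

/-! ### Sequences of time slots -/

/-- The gates in a time slot act on pairwise disjoint sets of qubits and are of the same kind. -/
def SlotOK (L : List (Gate Q)) : Prop :=
  L.Pairwise (fun g g' => Disjoint g.support g'.support) ∧ ∃ k, ∀ g ∈ L, g.kind = k

/-- The number of gates of kind `k` in a sequence of time slots. -/
def slotsCost (s : List (List (Gate Q))) (k : Kind) : ℕ :=
  s.flatten.countP fun g => decide (g.kind = k)

/-- The number of time slots holding a gate of kind `k`. -/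
def slotsDepth (s : List (List (Gate Q))) (k : Kind) : ℕ :=
  s.countP fun L => L.any fun g => decide (g.kind = k)

@[simp] theorem slotsCost_nil (k : Kind) : slotsCost ([] : List (List (Gate Q))) k = 0 := rfl

@[simp] theorem slotsDepth_nil (k : Kind) : slotsDepth ([] : List (List (Gate Q))) k = 0 := rfl

theorem slotsCost_cons (L : List (Gate Q)) (s : List (List (Gate Q))) (k : Kind) :
    slotsCost (L :: s) k = L.countP (fun g => decide (g.kind = k)) + slotsCost s k := by
  simp [slotsCost]

theorem slotsDepth_cons (L : List (Gate Q)) (s : List (List (Gate Q))) (k : Kind) :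
    slotsDepth (L :: s) k =
      (if L.any fun g => decide (g.kind = k) then 1 else 0) + slotsDepth s k := by
  simp [slotsDepth, List.countP_cons, add_comm]

theorem slotsCost_append (s s' : List (List (Gate Q))) (k : Kind) :
    slotsCost (s ++ s') k = slotsCost s k + slotsCost s' k := by
  simp [slotsCost]

theorem slotsDepth_append (s s' : List (List (Gate Q))) (k : Kind) :
    slotsDepth (s ++ s') k = slotsDepth s k + slotsDepth s' k := by
  simp [slotsDepth]

theorem slotOK_singleton (g : Gate Q) : SlotOK [g] := by simp [SlotOK]

theorem slotOK_pair {g g' : Gate Q} (hk : g.kind = g'.kind) (h : Disjoint g.support g'.support) :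
    SlotOK [g, g'] := by
  refine ⟨by simpa using h, g.kind, ?_⟩
  simp [hk]

/-- The inverse of a sequence of time slots. -/
def invSlots (s : List (List (Gate Q))) : List (List (Gate Q)) := (s.map invGates).reverse

theorem flatten_invSlots (s : List (List (Gate Q))) :
    (invSlots s).flatten = invGates s.flatten := by
  induction s with
  | nil => simp [invSlots, invGates]
  | cons L s ih =>
    have : invSlots (L :: s) = invSlots s ++ [invGates L] := by simp [invSlots]
    rw [this, List.flatten_append, ih]
    simp [invGates]

theorem slotOK_invGates {L : List (Gate Q)} (h : SlotOK L) : SlotOK (invGates L) := by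
  obtain ⟨hd, k, hk⟩ := h
  refine ⟨?_, k, ?_⟩
  · rw [invGates, List.pairwise_reverse, List.pairwise_map]
    refine hd.imp fun h => ?_
    simpa using h.symm
  · intro g hg
    simp only [invGates, List.mem_reverse, List.mem_map] at hg
    obtain ⟨g', hg', rfl⟩ := hg
    simpa using hk g' hg'

theorem slotOK_invSlots {s : List (List (Gate Q))} (h : ∀ L ∈ s, SlotOK L) :
    ∀ L ∈ invSlots s, SlotOK L := by
  intro L hL
  simp only [invSlots, List.mem_reverse, List.mem_map] at hL
  obtain ⟨L', hL', rfl⟩ := hL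
  exact slotOK_invGates (h L' hL')

theorem slotsCost_invSlots (s : List (List (Gate Q))) (k : Kind) :
    slotsCost (invSlots s) k = slotsCost s k := by
  rw [slotsCost, flatten_invSlots, invGates, List.countP_reverse, List.countP_map, slotsCost]
  congr 1
  funext g
  simp

theorem slotsDepth_invSlots (s : List (List (Gate Q))) (k : Kind) :
    slotsDepth (invSlots s) k = slotsDepth s k := by
  rw [slotsDepth, invSlots, List.countP_reverse, List.countP_map, slotsDepth]
  congr 1
  funext L
  simp [invGates, Function.comp_def]

/-- A time slot with at least two gates of kind `k` can be split into two. -/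
theorem exists_slots_depth_succ {s : List (List (Gate Q))} (hs : ∀ L ∈ s, SlotOK L) {k : Kind}
    (h : slotsDepth s k < slotsCost s k) :
    ∃ s' : List (List (Gate Q)), (∀ L ∈ s', SlotOK L) ∧ s'.flatten = s.flatten ∧
      slotsDepth s' k = slotsDepth s k + 1 ∧ ∀ k' ≠ k, slotsDepth s' k' = slotsDepth s k' := by
  induction s with
  | nil => simp at h
  | cons L s ih =>
    have hL := hs L (by simp)
    have hs' : ∀ L ∈ s, SlotOK L := fun L hL => hs L (by simp [hL])
    by_cases hlt : slotsDepth s k < slotsCost s k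
    · obtain ⟨s', h1, h2, h3, h4⟩ := ih hs' hlt
      refine ⟨L :: s', ?_, by simp [h2], ?_, ?_⟩
      · intro L' hL'
        rcases List.mem_cons.1 hL' with rfl | hL'
        · exact hL
        · exact h1 L' hL'
      · rw [slotsDepth_cons, h3, slotsDepth_cons, add_assoc]
      · intro k' hk'
        rw [slotsDepth_cons, h4 k' hk', slotsDepth_cons]
    · rw [slotsDepth_cons, slotsCost_cons] at h
      obtain ⟨hd, k₀, hk₀⟩ := hL
      match L, hd, hk₀, h with
      | [], _, _, h => simp at h; omega
      | [g], _, _, h =>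
        by_cases hg : g.kind = k <;> simp [hg] at h <;> omega
      | g :: g' :: L, hd, hk₀, h =>
        have hk : k₀ = k := by
          by_contra hne
          have : (g :: g' :: L).countP (fun g => decide (g.kind = k)) = 0 := by
            rw [List.countP_eq_zero]
            intro a ha
            simp [hk₀ a ha, hne]
          omega
        subst hk
        have e1 : g.kind = k₀ := hk₀ g (by simp)
        have e2 : g'.kind = k₀ := hk₀ g' (by simp)
        refine ⟨[g] :: (g' :: L) :: s, ?_, by simp, ?_, ?_⟩
        · intro L' hL'
          rcases List.mem_cons.1 hL' with rfl | hL'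
          · exact slotOK_singleton g
          rcases List.mem_cons.1 hL' with rfl | hL'
          · exact ⟨(List.pairwise_cons.1 hd).2, k₀, fun a ha => hk₀ a (by simp [List.mem_cons.1 ha])⟩
          · exact hs' L' hL'
        · simp [slotsDepth_cons, e1, e2]; omega
        · intro k' hk'
          have e3 : ∀ a ∈ L, ¬ a.kind = k' := fun a ha => by
            rw [hk₀ a (by simp [ha])]; exact hk'.symm
          simp [slotsDepth_cons, e1, e2, hk'.symm]

/-- By splitting time slots, the depth of one kind of gates can be raised to any value up to the
cost, with the same gates in the same order. -/
theorem exists_slots_depth_eq {s : List (List (Gate Q))} (hs : ∀ L ∈ s, SlotOK L) {k : Kind}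
    {d : ℕ} (h1 : slotsDepth s k ≤ d) (h2 : d ≤ slotsCost s k) :
    ∃ s' : List (List (Gate Q)), (∀ L ∈ s', SlotOK L) ∧ s'.flatten = s.flatten ∧
      slotsDepth s' k = d ∧ ∀ k' ≠ k, slotsDepth s' k' = slotsDepth s k' := by
  induction d, h1 using Nat.le_induction with
  | base => exact ⟨s, hs, rfl, rfl, fun _ _ => rfl⟩
  | succ d _ ih =>
    obtain ⟨s₁, h3, h4, h5, h6⟩ := ih (by omega)
    have h7 : slotsCost s₁ k = slotsCost s k := by rw [slotsCost, h4, slotsCost]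
    obtain ⟨s₂, g3, g4, g5, g6⟩ := exists_slots_depth_succ h3 (k := k) (by omega)
    exact ⟨s₂, g3, g4.trans h4, by omega, fun k' hk' => (g6 k' hk').trans (h6 k' hk')⟩

/-! ### The pipelined ladder of relative-phase Toffoli gates -/

/-- The gates of a ladder. -/
def ladderGates (rs : List (Rung Q)) : List (Gate Q) := rs.flatMap Rung.gates

/-- The Hadamard gate that opens the first rung of a ladder. -/
def headH (rs : List (Rung Q)) : List (Gate Q) := (rs.head?.map fun ρ => Gate.H ρ.tgt).toList

/-- The time slots of a ladder after the first half of its first rung `ρ` and the opening Hadamard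
gate of its second rung. The second half of each rung runs in parallel to the first half of the
next one, and its closing Hadamard gate to the opening one of the second next rung. -/
def ladderTail (ρ : Rung Q) : List (Rung Q) → List (List (Gate Q))
  | [] => [[cx ρ.mid ρ.tgt], [tGate (ρ.ps = ρ.pm) ρ.tgt], [cx ρ.side ρ.tgt],
      [tGate (ρ.pm = 0) ρ.tgt], [.H ρ.tgt]]
  | ρ' :: rs =>
      [cx ρ.mid ρ.tgt] :: [tGate (ρ.ps = ρ.pm) ρ.tgt, tGate true ρ'.tgt] ::
      [cx ρ.side ρ.tgt, cx ρ'.side ρ'.tgt] ::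
      [tGate (ρ.pm = 0) ρ.tgt, tGate (ρ'.ps = 0) ρ'.tgt] ::
      (.H ρ.tgt :: headH rs) :: ladderTail ρ' rs

/-- The time slots of the ladder with rungs `ρ :: rs`; the gates in `extra` are executed in
parallel to the first Hadamard gates. -/
def ladderSlots (extra : List (Gate Q)) (ρ : Rung Q) (rs : List (Rung Q)) :
    List (List (Gate Q)) :=
  (extra ++ .H ρ.tgt :: headH rs) :: [tGate true ρ.tgt] :: [cx ρ.side ρ.tgt] ::
    [tGate (ρ.ps = 0) ρ.tgt] :: ladderTail ρ rs

/-- The conditions on two consecutive rungs under which they can be pipelined. -/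
def Rung.Follows (ρ ρ' : Rung Q) : Prop :=
  ρ'.tgt ≠ ρ.tgt ∧ ρ'.tgt ≠ ρ.mid ∧ ρ'.tgt ≠ ρ.side ∧ ρ'.side ≠ ρ.tgt ∧ ρ'.side ≠ ρ.side

/-- The conditions on a sequence of rungs under which it can be pipelined. -/
structure LadderOK (rs : List (Rung Q)) : Prop where
  valid : ∀ ρ ∈ rs, ρ.Valid
  chain : rs.IsChain Rung.Follows
  tgt : rs.Pairwise fun ρ ρ' => ρ.tgt ≠ ρ'.tgt

theorem LadderOK.tail {ρ : Rung Q} {rs : List (Rung Q)} (h : LadderOK (ρ :: rs)) : LadderOK rs :=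
  ⟨fun ρ' h' => h.valid ρ' (by simp [h']), h.chain.tail, (List.pairwise_cons.1 h.tgt).2⟩

@[simp] theorem support_H (q : Q) : (Gate.H q).support = {q} := rfl

@[simp] theorem support_tGate (b : Bool) (q : Q) : (tGate b q).support = {q} := by cases b <;> rfl

theorem support_cx {c t : Q} (h : c ≠ t) : (cx c t).support = {c, t} := by
  simp [cx, h, Gate.support]

@[simp] theorem kind_tGate (b : Bool) (q : Q) : (tGate b q).kind = .t := by cases b <;> rfl

theorem kind_cx {c t : Q} (h : c ≠ t) : (cx c t).kind = .cnot := by simp [cx, h, Gate.kind]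

@[simp] theorem kind_H (q : Q) : (Gate.H q).kind = .h := rfl

theorem mem_headH {rs : List (Rung Q)} {g : Gate Q} (h : g ∈ headH rs) :
    ∃ ρ ∈ rs, rs.head? = some ρ ∧ g = .H ρ.tgt := by
  cases rs with
  | nil => simp [headH] at h
  | cons ρ rs =>
    simp only [headH, List.head?_cons, Option.map_some, Option.toList_some,
      List.mem_singleton] at h
    exact ⟨ρ, by simp, rfl, h⟩

theorem slotOK_H_headH {ρ : Rung Q} {rs : List (Rung Q)} (h : ∀ ρ' ∈ rs, ρ.tgt ≠ ρ'.tgt) :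
    SlotOK (.H ρ.tgt :: headH rs) := by
  cases rs with
  | nil => exact slotOK_singleton _
  | cons ρ' rs =>
    refine slotOK_pair rfl ?_
    simpa using h ρ' (by simp)

theorem slotOK_ladderTail {ρ : Rung Q} {rs : List (Rung Q)} (h : LadderOK (ρ :: rs)) :
    ∀ L ∈ ladderTail ρ rs, SlotOK L := by
  induction rs generalizing ρ with
  | nil =>
    intro L hL
    simp only [ladderTail, List.mem_cons, List.not_mem_nil, or_false] at hL
    rcases hL with rfl | rfl | rfl | rfl | rfl <;> exact slotOK_singleton _
  | cons ρ' rs ih =>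
    intro L hL
    have hv := h.valid ρ (by simp)
    have hv' := h.valid ρ' (by simp)
    have hf : ρ.Follows ρ' := (List.isChain_cons_cons.1 h.chain).1
    obtain ⟨f1, f2, f3, f4, f5⟩ := hf
    simp only [ladderTail, List.mem_cons] at hL
    rcases hL with rfl | rfl | rfl | rfl | rfl | hL
    · exact slotOK_singleton _
    · exact slotOK_pair (by simp) (by simpa using f1.symm)
    · refine slotOK_pair (by rw [kind_cx hv.2.1, kind_cx hv'.2.1]) ?_
      rw [support_cx hv.2.1, support_cx hv'.2.1]
      simp [f1, f3, f4, f5]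
    · exact slotOK_pair (by simp) (by simpa using f1.symm)
    · exact slotOK_H_headH fun ρ'' h'' => (List.pairwise_cons.1 h.tgt).1 ρ'' (by simp [h''])
    · exact ih h.tail L hL

theorem slotOK_ladderSlots {extra : List (Gate Q)} {ρ : Rung Q} {rs : List (Rung Q)}
    (h : LadderOK (ρ :: rs)) (h1 : SlotOK (extra ++ .H ρ.tgt :: headH rs)) :
    ∀ L ∈ ladderSlots extra ρ rs, SlotOK L := by
  intro L hL
  simp only [ladderSlots, List.mem_cons] at hL
  rcases hL with rfl | rfl | rfl | rfl | hL
  · exact h1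
  iterate 3 exact slotOK_singleton _
  · exact slotOK_ladderTail h L hL

variable [Fintype Q]

/-- Proved by induction, with the opening Hadamard gate of the second rung moved to the front. -/
theorem gatesOp_ladderTail {ρ : Rung Q} {rs : List (Rung Q)} (h : LadderOK (ρ :: rs)) :
    gatesOp (headH rs ++ (ladderTail ρ rs).flatten) =
      gatesOp ([cx ρ.mid ρ.tgt, tGate (ρ.ps = ρ.pm) ρ.tgt, cx ρ.side ρ.tgt,
        tGate (ρ.pm = 0) ρ.tgt, .H ρ.tgt] ++ ladderGates rs) := by
  induction rs generalizing ρ with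
  | nil => simp [headH, ladderTail, ladderGates]
  | cons ρ' rs ih =>
    have hv := h.valid ρ (by simp)
    have hv' := h.valid ρ' (by simp)
    obtain ⟨f1, f2, f3, f4, f5⟩ := (List.isChain_cons_cons.1 h.chain).1
    have ih := ih h.tail
    -- the opening Hadamard gate of the second rung commutes with the second half of the first
    have c1 : Commute (gatesOp [Gate.H ρ'.tgt]) (gatesOp [cx ρ.mid ρ.tgt,
        tGate (ρ.ps = ρ.pm) ρ.tgt, cx ρ.side ρ.tgt, tGate (ρ.pm = 0) ρ.tgt, .H ρ.tgt]) := by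
      apply gatesOp_commute
      simp [support_cx hv.1, support_cx hv.2.1, f1.symm, f2.symm, f3.symm]
    -- the gates of the second rung commute with those of the first one they are moved across
    have d1 : Disjoint (cx ρ.side ρ.tgt).support ({ρ'.tgt} : Finset Q) := by
      simp [support_cx hv.2.1, f1, f3]
    have d2 : Disjoint ({ρ.tgt} : Finset Q) ({ρ'.tgt} : Finset Q) := by simp [f1.symm]
    have d3 : Disjoint ({ρ.tgt} : Finset Q) (cx ρ'.side ρ'.tgt).support := by
      simp [support_cx hv'.2.1, f1.symm, f4.symm]
    have c2 : Commute (cx ρ.side ρ.tgt).op (tGate true ρ'.tgt).op :=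
      Gate.op_commute (by simpa using d1)
    have c3 : Commute (tGate (ρ.pm = 0) ρ.tgt).op (tGate true ρ'.tgt).op :=
      Gate.op_commute (by simpa using d2)
    have c4 : Commute (Gate.H ρ.tgt).op (tGate true ρ'.tgt).op :=
      Gate.op_commute (by simpa using d2)
    have c5 : Commute (tGate (ρ.pm = 0) ρ.tgt).op (cx ρ'.side ρ'.tgt).op :=
      Gate.op_commute (by simpa using d3)
    have c6 : Commute (Gate.H ρ.tgt).op (cx ρ'.side ρ'.tgt).op :=
      Gate.op_commute (by simpa using d3)
    have c7 : Commute (Gate.H ρ.tgt).op (tGate (ρ'.ps = 0) ρ'.tgt).op :=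
      Gate.op_commute (by simpa using d2)
    have e1 : headH (ρ' :: rs) = [Gate.H ρ'.tgt] := rfl
    have e2 : ladderGates (ρ' :: rs) = [Gate.H ρ'.tgt] ++
        ([tGate true ρ'.tgt, cx ρ'.side ρ'.tgt, tGate (ρ'.ps = 0) ρ'.tgt] ++
        ([cx ρ'.mid ρ'.tgt, tGate (ρ'.ps = ρ'.pm) ρ'.tgt, cx ρ'.side ρ'.tgt,
          tGate (ρ'.pm = 0) ρ'.tgt, .H ρ'.tgt] ++ ladderGates rs)) := by
      simp [ladderGates, Rung.gates, ccGates]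
    have e3 : (ladderTail ρ (ρ' :: rs)).flatten = [cx ρ.mid ρ.tgt, tGate (ρ.ps = ρ.pm) ρ.tgt,
        tGate true ρ'.tgt, cx ρ.side ρ.tgt, cx ρ'.side ρ'.tgt, tGate (ρ.pm = 0) ρ.tgt,
        tGate (ρ'.ps = 0) ρ'.tgt, .H ρ.tgt] ++ (headH rs ++ (ladderTail ρ' rs).flatten) := by
      simp [ladderTail]
    rw [e1, e2, gatesOp_append _ (ladderTail _ _).flatten, gatesOp_append _ ([Gate.H ρ'.tgt] ++ _),
      gatesOp_append [Gate.H ρ'.tgt], mul_assoc, c1.eq, ← mul_assoc]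
    congr 1
    rw [e3, gatesOp_append, gatesOp_append [tGate true ρ'.tgt, _, _], ih]
    simp only [gatesOp_cons, gatesOp_nil, one_mul, mul_assoc, c2.eq, c3.left_comm,
      c4.left_comm, c5.left_comm, c6.left_comm, c7.left_comm]

/-- The pipelined schedule executes the rungs one after the other. -/
theorem gatesOp_ladderSlots (extra : List (Gate Q)) {ρ : Rung Q} {rs : List (Rung Q)}
    (h : LadderOK (ρ :: rs)) :
    gatesOp (ladderSlots extra ρ rs).flatten =
      gatesOp (ladderGates (ρ :: rs)) * gatesOp extra := by
  have hv := h.valid ρ (by simp)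
  -- the opening Hadamard gate of the second rung commutes with the first half of the first rung
  have c : Commute (gatesOp [tGate true ρ.tgt, cx ρ.side ρ.tgt, tGate (ρ.ps = 0) ρ.tgt])
      (gatesOp (headH rs)) := by
    apply gatesOp_commute
    intro g hg g' hg'
    obtain ⟨ρ', h1, h2, rfl⟩ := mem_headH hg'
    obtain ⟨rs', rfl⟩ : ∃ rs', rs = ρ' :: rs' := by
      cases rs with
      | nil => simp at h1
      | cons a rs => simp at h2; exact ⟨rs, by rw [h2]⟩
    obtain ⟨f1, f2, f3, f4, f5⟩ := (List.isChain_cons_cons.1 h.chain).1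
    simp only [List.mem_cons, List.not_mem_nil, or_false] at hg
    rcases hg with rfl | rfl | rfl <;> simp [support_cx hv.2.1, f1, f3, f1.symm]
  have e1 : (ladderSlots extra ρ rs).flatten = extra ++ ([Gate.H ρ.tgt] ++ (headH rs ++
      ([tGate true ρ.tgt, cx ρ.side ρ.tgt, tGate (ρ.ps = 0) ρ.tgt] ++
        (ladderTail ρ rs).flatten))) := by
    simp [ladderSlots]
  have e2 : ladderGates (ρ :: rs) = [Gate.H ρ.tgt] ++
      ([tGate true ρ.tgt, cx ρ.side ρ.tgt, tGate (ρ.ps = 0) ρ.tgt] ++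
      ([cx ρ.mid ρ.tgt, tGate (ρ.ps = ρ.pm) ρ.tgt, cx ρ.side ρ.tgt,
        tGate (ρ.pm = 0) ρ.tgt, .H ρ.tgt] ++ ladderGates rs)) := by
    simp [ladderGates, Rung.gates, ccGates]
  rw [e1, e2, gatesOp_append extra]
  congr 1
  rw [gatesOp_append [Gate.H ρ.tgt], gatesOp_append [Gate.H ρ.tgt]]
  congr 1
  rw [gatesOp_append (headH rs), gatesOp_append [_, _, _], mul_assoc, c.eq, ← mul_assoc,
    ← gatesOp_append, gatesOp_ladderTail h, ← gatesOp_append]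

end

/-! ### Costs and depths of ladders -/

section

variable {Q : Type} [DecidableEq Q]

/-- The opening Hadamard gate of the second rung, which is not part of the time slots, is added on the
left-hand side of the Hadamard cost. -/
theorem ladderTail_resources {ρ : Rung Q} {rs : List (Rung Q)}
    (h : ∀ ρ' ∈ ρ :: rs, Rung.Valid ρ') :
    slotsCost (ladderTail ρ rs) .rot = 0 ∧
    slotsCost (ladderTail ρ rs) .cnot = 3 * rs.length + 2 ∧
    slotsDepth (ladderTail ρ rs) .cnot = 2 * rs.length + 2 ∧
    slotsCost (ladderTail ρ rs) .t = 4 * rs.length + 2 ∧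
    slotsDepth (ladderTail ρ rs) .t = 2 * rs.length + 2 ∧
    slotsCost (ladderTail ρ rs) .h + (headH rs).length = 2 * rs.length + 1 ∧
    slotsDepth (ladderTail ρ rs) .h = rs.length + 1 := by
  induction rs generalizing ρ with
  | nil =>
    have hv := h ρ (by simp)
    simp [ladderTail, slotsCost_cons, slotsDepth_cons, headH, kind_cx hv.1, kind_cx hv.2.1]
  | cons ρ' rs ih =>
    have hv := h ρ (by simp)
    have hv' := h ρ' (by simp)
    obtain ⟨h1, h2, h3, h4, h5, h6, h7⟩ := ih (ρ := ρ') fun ρ'' h'' => h ρ'' (by simp_all)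
    have hH : ∀ g ∈ headH rs, g.kind = .h := by
      intro g hg
      obtain ⟨_, _, _, rfl⟩ := mem_headH hg
      rfl
    have k1 : ∀ k, k ≠ .h → (headH rs).countP (fun g => decide (g.kind = k)) = 0 := by
      intro k hk
      rw [List.countP_eq_zero]
      intro g hg
      simp [hH g hg, hk.symm]
    have k2 : (headH rs).countP (fun g => decide (g.kind = .h)) = (headH rs).length := by
      rw [List.countP_eq_length]
      intro g hg
      simp [hH g hg]
    have k3 : ∀ k, k ≠ .h → ¬ ∃ g ∈ headH rs, g.kind = k := by
      rintro k hk ⟨g, hg, rfl⟩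
      exact hk (hH g hg)
    have e : (headH (ρ' :: rs)).length = 1 := rfl
    simp [ladderTail, slotsCost_cons, slotsDepth_cons, kind_cx hv.1, kind_cx hv.2.1,
      kind_cx hv'.2.1, h1, h2, h3, h4, h5, h7, k1, k2, k3, e]
    omega

theorem ladderSlots_resources {extra : List (Gate Q)} {ρ : Rung Q} {rs : List (Rung Q)}
    (h : ∀ ρ' ∈ ρ :: rs, Rung.Valid ρ') (he : ∀ g ∈ extra, g.kind = .h) :
    slotsCost (ladderSlots extra ρ rs) .rot = 0 ∧
    slotsCost (ladderSlots extra ρ rs) .cnot = 3 * (rs.length + 1) ∧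
    slotsDepth (ladderSlots extra ρ rs) .cnot = 2 * (rs.length + 1) + 1 ∧
    slotsCost (ladderSlots extra ρ rs) .t = 4 * (rs.length + 1) ∧
    slotsDepth (ladderSlots extra ρ rs) .t = 2 * (rs.length + 1) + 2 ∧
    slotsCost (ladderSlots extra ρ rs) .h = extra.length + 2 * (rs.length + 1) ∧
    slotsDepth (ladderSlots extra ρ rs) .h = rs.length + 2 := by
  have hv := h ρ (by simp)
  obtain ⟨h1, h2, h3, h4, h5, h6, h7⟩ := ladderTail_resources h
  have hH : ∀ g ∈ extra ++ .H ρ.tgt :: headH rs, g.kind = .h := by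
    intro g hg
    rcases List.mem_append.1 hg with hg | hg
    · exact he g hg
    rcases List.mem_cons.1 hg with rfl | hg
    · rfl
    obtain ⟨_, _, _, rfl⟩ := mem_headH hg
    rfl
  generalize hL : extra ++ .H ρ.tgt :: headH rs = L at hH
  have hlen : L.length = extra.length + 1 + (headH rs).length := by rw [← hL]; simp; omega
  have k1 : ∀ k, k ≠ .h → L.countP (fun g => decide (g.kind = k)) = 0 := by
    intro k hk
    rw [List.countP_eq_zero]
    intro g hg
    simp [hH g hg, hk.symm]
  have k2 : L.countP (fun g => decide (g.kind = .h)) = L.length := by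
    rw [List.countP_eq_length]
    intro g hg
    simp [hH g hg]
  have k3 : ∀ k, k ≠ .h → ¬ ∃ g ∈ L, g.kind = k := by
    rintro k hk ⟨g, hg, rfl⟩
    exact hk (hH g hg)
  have k4 : ∃ g ∈ L, g.kind = .h := ⟨.H ρ.tgt, by rw [← hL]; simp, rfl⟩
  simp [ladderSlots, hL, slotsCost_cons, slotsDepth_cons, kind_cx hv.2.1,
    h1, h2, h3, h4, h5, h7, k1, k2, k3, k4]
  omega

end

noncomputable section

variable {Q : Type} [DecidableEq Q]

/-! ### Classical action of ladders on conditionally clean qubits -/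

/-- The action of a ladder on computational basis states, up to phases. -/
def actList (rs : List (Rung Q)) (x : Basis Q) : Basis Q := rs.foldl (fun x ρ => ρ.act x) x

@[simp] theorem actList_nil (x : Basis Q) : actList [] x = x := rfl

theorem actList_append (rs rs' : List (Rung Q)) (x : Basis Q) :
    actList (rs ++ rs') x = actList rs' (actList rs x) := by simp [actList]

theorem actList_cons (ρ : Rung Q) (rs : List (Rung Q)) (x : Basis Q) :
    actList (ρ :: rs) x = actList rs (ρ.act x) := rfl

theorem ladder_isMonomial [Fintype Q] {rs : List (Rung Q)} (h : ∀ ρ ∈ rs, Rung.Valid ρ) :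
    IsMonomial (gatesOp (ladderGates rs)) (actList rs) := by
  induction rs with
  | nil =>
    rw [show gatesOp (ladderGates ([] : List (Rung Q))) = 1 by simp [ladderGates]]
    exact isMonomial_one
  | cons ρ rs ih =>
    have : ladderGates (ρ :: rs) = ρ.gates ++ ladderGates rs := by simp [ladderGates]
    rw [this, gatesOp_append]
    exact (ih fun ρ' h' => h ρ' (by simp [h'])).mul (Rung.isMonomial (h ρ (by simp)))

theorem Rung.act_of_ne {ρ : Rung Q} {q : Q} (h : q ≠ ρ.tgt) (x : Basis Q) : ρ.act x q = x q := by
  rw [Rung.act]; split_ifs <;> simp [h]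

theorem Rung.act_tgt (ρ : Rung Q) (x : Basis Q) : ρ.act x ρ.tgt =
    x ρ.tgt + if x ρ.side = ρ.ps ∧ x ρ.mid = ρ.pm then 1 else 0 := by
  rw [Rung.act]; split_ifs <;> simp

theorem actList_of_ne {rs : List (Rung Q)} {q : Q} (h : ∀ ρ ∈ rs, q ≠ ρ.tgt) (x : Basis Q) :
    actList rs x q = x q := by
  induction rs generalizing x with
  | nil => rfl
  | cons ρ rs ih =>
    rw [actList_cons, ih (fun ρ' h' => h ρ' (by simp [h'])), Rung.act_of_ne (h ρ (by simp))]

/-- A qubit that a ladder does not act on has no influence on the others. -/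
theorem actList_congr {rs : List (Rung Q)} {t : Q}
    (h : ∀ ρ ∈ rs, t ≠ ρ.tgt ∧ t ≠ ρ.mid ∧ t ≠ ρ.side) {x y : Basis Q}
    (hxy : ∀ q, q ≠ t → x q = y q) : ∀ q, q ≠ t → actList rs x q = actList rs y q := by
  induction rs generalizing x y with
  | nil => exact hxy
  | cons ρ rs ih =>
    rw [actList_cons, actList_cons]
    refine ih (fun ρ' h' => h ρ' (by simp [h'])) fun q hq => ?_
    obtain ⟨h1, h2, h3⟩ := h ρ (by simp)
    rw [Rung.act, Rung.act, hxy _ h2.symm, hxy _ h3.symm, hxy _ h1.symm]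
    split_ifs
    · by_cases hqt : q = ρ.tgt
      · subst hqt; simp
      · simp [hqt, hxy q hq]
    · exact hxy q hq

/-- The first part of the ladder: the rung `i` writes the conjunction of the qubits `i + 2` and
`p + 2 + i` onto the qubit `i`. -/
def upRungs (c : ℕ → Q) (p j : ℕ) : List (Rung Q) :=
  (List.range j).map fun i => ⟨c i, c (i + 2), c (p + 2 + i), 1, 1⟩

/-- The second part of the ladder: starting from the qubit `y`, the negated conjunction with the
qubits `i, …, 1` is accumulated on the qubits `p + 1 + i, …, p + 2`. -/
def downRungs (c : ℕ → Q) (p : ℕ) (y : Q) : ℕ → List (Rung Q)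
  | 0 => []
  | i + 1 => ⟨c (p + 2 + i), y, c (i + 1), 0, 0⟩ :: downRungs c p (c (p + 2 + i)) i

/-- The qubit that holds the result of the second part of the ladder. -/
def downOut (c : ℕ → Q) (p : ℕ) (y : Q) : ℕ → Q
  | 0 => y
  | i + 1 => downOut c p (c (p + 2 + i)) i

/-- The controls of a rung in the first part are no targets of earlier rungs. -/
theorem upRungs_act {c : ℕ → Q} {n p j : ℕ} (hc : ∀ i < n, ∀ j < n, i ≠ j → c i ≠ c j)
    (hp : 2 * p + 2 ≤ n) (hj : j ≤ p) (x : Basis Q) (i : ℕ) (hi : i < n) :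
    actList (upRungs c p j) x (c i) = x (c i) +
      if i < j ∧ x (c (p + 2 + i)) = 1 ∧ x (c (i + 2)) = 1 then 1 else 0 := by
  induction j generalizing i with
  | zero => simp [upRungs, actList]
  | succ j ih =>
    have e : upRungs c p (j + 1) = upRungs c p j ++ [⟨c j, c (j + 2), c (p + 2 + j), 1, 1⟩] := by
      simp [upRungs, List.range_succ]
    rw [e, actList_append]
    have ih := ih (by omega)
    by_cases hij : i = j
    · subst hij
      have := Rung.act_tgt ⟨c i, c (i + 2), c (p + 2 + i), 1, 1⟩ (actList (upRungs c p i) x)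
      simp only [actList_cons] at this ⊢
      rw [actList_nil, this, ih i hi, ih (p + 2 + i) (by omega),
        ih (i + 2) (by omega)]
      simp
    · rw [actList_cons, actList_nil, Rung.act_of_ne, ih i hi]
      · congr 2
        simp only [eq_iff_iff, and_congr_left_iff]
        omega
      · exact hc i hi j (by omega) hij

/-- If the qubits `0` and `1` are in state `1`, then the first part of the ladder leaves its first
`j` targets in state `0` exactly if all the controls of its first `j` rungs are in state `1`. The
target of a rung is a control of an earlier one, and hence in state `1` if the earlier conjunctions
are true. -/
theorem upRungs_flags {c : ℕ → Q} {n p j : ℕ} (hc : ∀ i < n, ∀ j < n, i ≠ j → c i ≠ c j)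
    (hp : 2 * p + 2 ≤ n) (hj : j ≤ p) {x : Basis Q} (h0 : x (c 0) = 1) (h1 : x (c 1) = 1) :
    (∀ l < j, actList (upRungs c p p) x (c l) = 0) ↔
      ∀ l < j, x (c (l + 2)) = 1 ∧ x (c (p + 2 + l)) = 1 := by
  induction j with
  | zero => simp
  | succ j ih =>
    have ih := ih (by omega)
    rw [Nat.forall_lt_succ_right, Nat.forall_lt_succ_right, ih]
    refine and_congr_right fun h => ?_
    have hx : x (c j) = 1 := by
      match j, h with
      | 0, _ => exact h0
      | 1, _ => exact h1
      | l + 2, h => exact (h l (by omega)).1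
    rw [upRungs_act hc hp le_rfl x j (by omega), hx]
    simp only [show j < p by omega, true_and]
    split_ifs with h' <;> simp <;> tauto

theorem downRungs_tgt {c : ℕ → Q} {p i : ℕ} {y : Q} {ρ : Rung Q} (h : ρ ∈ downRungs c p y i) :
    ∃ j < i, ρ.tgt = c (p + 2 + j) := by
  induction i generalizing y with
  | zero => simp [downRungs] at h
  | succ i ih =>
    rw [downRungs, List.mem_cons] at h
    rcases h with rfl | h
    · exact ⟨i, by omega, rfl⟩
    · obtain ⟨j, hj, h⟩ := ih h
      exact ⟨j, by omega, h⟩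

/-- The second part of the ladder, if its targets are in state `1` as soon as the qubits
`0, …, j` are in state `0`. -/
theorem downRungs_act {c : ℕ → Q} {n p i k : ℕ} (hc : ∀ i < n, ∀ j < n, i ≠ j → c i ≠ c j)
    (hp : 2 * p + 2 ≤ n) (hi : i + 1 < p) (hik : p + 2 + i ≤ k ∨ k < p + 2) (hkn : k < n)
    {s : Basis Q} (h0 : s (c 0) = 0)
    (h : ∀ j < i, (∀ l ≤ j, s (c l) = 0) → s (c (p + 2 + j)) = 1) :
    actList (downRungs c p (c k) i) s (downOut c p (c k) i) = 0 ↔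
      s (c k) = 0 ∧ ∀ l ≤ i, s (c l) = 0 := by
  induction i generalizing k s with
  | zero => simp [downRungs, downOut, actList, h0]
  | succ i ih =>
    rw [downRungs, downOut, actList_cons]
    set ρ : Rung Q := ⟨c (p + 2 + i), c k, c (i + 1), 0, 0⟩ with hρ
    have hs : ∀ l < n, l ≠ p + 2 + i → ρ.act s (c l) = s (c l) := fun l hl hl' =>
      Rung.act_of_ne (hc l hl _ (by omega) hl') s
    have ht : ρ.act s (c (p + 2 + i)) =
        s (c (p + 2 + i)) + if s (c (i + 1)) = 0 ∧ s (c k) = 0 then 1 else 0 := Rung.act_tgt ρ s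
    have hl : (∀ l ≤ i, ρ.act s (c l) = 0) ↔ ∀ l ≤ i, s (c l) = 0 :=
      forall₂_congr fun l hl => by rw [hs l (by omega) (by omega)]
    rw [ih (by omega) (by omega) (by omega) (by rw [hs 0 (by omega) (by omega), h0]), hl, ht]
    · have hle : (∀ l ≤ i + 1, s (c l) = 0) ↔ s (c (i + 1)) = 0 ∧ ∀ l ≤ i, s (c l) = 0 := by
        constructor
        · exact fun h => ⟨h _ le_rfl, fun l hl => h l (by omega)⟩
        · rintro ⟨h1, h2⟩ l hl
          rcases Nat.le_succ_iff.1 hl with hl | rfl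
          · exact h2 l hl
          · exact h1
      rw [hle, and_comm, ← and_assoc, and_comm (a := _ ∧ _), and_comm (a := s (c k) = 0)]
      refine and_congr_right fun hall => ?_
      rw [h i (by omega) hall]
      split_ifs with h' <;> simp [h']
    · intro j hj hall
      rw [hs _ (by omega) (by omega)]
      refine h j (by omega) fun l hl => ?_
      rw [← hs l (by omega) (by omega)]
      exact hall l hl

/-- The ladder on the qubits `c 0, …, c (n - 1)`. For odd `n`, the last qubit is the control of one
further rung between the two parts. -/
def ladder (c : ℕ → Q) (n : ℕ) : List (Rung Q) :=
  upRungs c ((n - 2) / 2) ((n - 2) / 2) ++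
    if n % 2 = 0 then downRungs c ((n - 2) / 2) (c ((n - 2) / 2 - 1)) ((n - 2) / 2 - 2)
    else ⟨c (2 * ((n - 2) / 2)), c ((n - 2) / 2 - 1), c (n - 1), 1, 0⟩ ::
      downRungs c ((n - 2) / 2) (c (2 * ((n - 2) / 2))) ((n - 2) / 2 - 2)

/-- The qubit that holds the result of a ladder. -/
def ladderOut (c : ℕ → Q) (n : ℕ) : Q :=
  if n % 2 = 0 then downOut c ((n - 2) / 2) (c ((n - 2) / 2 - 1)) ((n - 2) / 2 - 2)
  else downOut c ((n - 2) / 2) (c (2 * ((n - 2) / 2))) ((n - 2) / 2 - 2)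

theorem ladder_even (c : ℕ → Q) (q : ℕ) : ladder c (2 * q + 6) =
    upRungs c (q + 2) (q + 2) ++ downRungs c (q + 2) (c (q + 1)) q := by
  rw [ladder, if_pos (by omega), show (2 * q + 6 - 2) / 2 = q + 2 by omega]
  simp

theorem ladder_odd (c : ℕ → Q) (q : ℕ) : ladder c (2 * q + 7) =
    upRungs c (q + 2) (q + 2) ++ ⟨c (q + 2 + 2 + q), c (q + 1), c (2 * q + 6), 1, 0⟩ ::
      downRungs c (q + 2) (c (q + 2 + 2 + q)) q := by
  rw [ladder, if_neg (by omega), show (2 * q + 7 - 2) / 2 = q + 2 by omega]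
  simp [show 2 * (q + 2) = q + 2 + 2 + q by omega]

theorem ladderOut_even (c : ℕ → Q) (q : ℕ) : ladderOut c (2 * q + 6) =
    downOut c (q + 2) (c (q + 1)) q := by
  rw [ladderOut, if_pos (by omega), show (2 * q + 6 - 2) / 2 = q + 2 by omega]
  simp

theorem ladderOut_odd (c : ℕ → Q) (q : ℕ) : ladderOut c (2 * q + 7) =
    downOut c (q + 2) (c (q + 2 + 2 + q)) q := by
  rw [ladderOut, if_neg (by omega), show (2 * q + 7 - 2) / 2 = q + 2 by omega]
  simp [show 2 * (q + 2) = q + 2 + 2 + q by omega]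

theorem downOut_mem (c : ℕ → Q) (p : ℕ) (y : Q) (i : ℕ) :
    downOut c p y i = y ∨ ∃ k, downOut c p y i = c k := by
  induction i generalizing y with
  | zero => exact .inl rfl
  | succ i ih =>
    rw [downOut]
    rcases ih (c (p + 2 + i)) with h | h
    · exact .inr ⟨_, h⟩
    · exact .inr h

theorem ladderOut_mem (c : ℕ → Q) (n : ℕ) : ∃ k, ladderOut c n = c k := by
  rw [ladderOut]
  split_ifs
  · rcases downOut_mem c ((n - 2) / 2) (c ((n - 2) / 2 - 1)) ((n - 2) / 2 - 2) with h | h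
    exacts [⟨_, h⟩, h]
  · rcases downOut_mem c ((n - 2) / 2) (c (2 * ((n - 2) / 2))) ((n - 2) / 2 - 2) with h | h
    exacts [⟨_, h⟩, h]

/-- If the qubits `0` and `1` are in state `1`, then the ladder leaves the qubit `0` and its output
qubit in state `0` exactly if all qubits are in state `1`. -/
theorem ladder_act {c : ℕ → Q} {n : ℕ} (hn : 6 ≤ n)
    (hc : ∀ i < n, ∀ j < n, i ≠ j → c i ≠ c j) {x : Basis Q} (h0 : x (c 0) = 1)
    (h1 : x (c 1) = 1) :
    (actList (ladder c n) x (c 0) = 0 ∧ actList (ladder c n) x (ladderOut c n) = 0) ↔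
      ∀ i < n, x (c i) = 1 := by
  obtain ⟨q, rfl | rfl⟩ : ∃ q, n = 2 * q + 6 ∨ n = 2 * q + 7 :=
    ⟨(n - 6) / 2, by omega⟩
  all_goals
    set s := actList (upRungs c (q + 2) (q + 2)) x with hs
    have flags : ∀ j ≤ q + 2, (∀ l < j, s (c l) = 0) ↔
        ∀ l < j, x (c (l + 2)) = 1 ∧ x (c (q + 2 + 2 + l)) = 1 := fun j hj =>
      upRungs_flags hc (by omega) hj h0 h1
    have hup : ∀ i, q + 2 ≤ i → i < 2 * q + 6 + 1 → (hi : i < _) → s (c i) = x (c i) :=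
      fun i hi _ hi' => by
        rw [hs, upRungs_act hc (by omega) le_rfl x i hi', if_neg (by omega), add_zero]
    have hclean : ∀ j < q + 2, (∀ l ≤ j, s (c l) = 0) → s (c (q + 2 + 2 + j)) = 1 := by
      intro j hj h
      rw [hup _ (by omega) (by omega) (by omega)]
      exact ((flags (j + 1) (by omega)).1 (fun l hl => h l (by omega)) j (by omega)).2
  · rw [ladder_even, ladderOut_even, actList_append, ← hs, actList_of_ne (q := c 0)]
    swap
    · intro ρ hρ
      obtain ⟨j, hj, h⟩ := downRungs_tgt hρ
      rw [h]
      exact hc _ (by omega) _ (by omega) (by omega)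
    have key : (s (c 0) = 0 ∧ actList (downRungs c (q + 2) (c (q + 1)) q) s
        (downOut c (q + 2) (c (q + 1)) q) = 0) ↔ ∀ l < q + 2, s (c l) = 0 := by
      constructor
      · rintro ⟨g0, g⟩
        rw [downRungs_act hc (by omega) (by omega) (by omega) (by omega) g0
          fun j hj => hclean j (by omega)] at g
        intro l hl
        rcases Nat.lt_succ_iff_lt_or_eq.1 hl with hl | rfl
        exacts [g.2 l (by omega), g.1]
      · intro g
        refine ⟨g 0 (by omega), ?_⟩
        rw [downRungs_act hc (by omega) (by omega) (by omega) (by omega) (g 0 (by omega))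
          fun j hj => hclean j (by omega)]
        exact ⟨g _ (by omega), fun l hl => g l (by omega)⟩
    rw [key, flags _ le_rfl]
    constructor
    · intro g i hi
      rcases Nat.lt_or_ge i 2 with h2 | h2
      · interval_cases i <;> assumption
      rcases Nat.lt_or_ge i (q + 2 + 2) with h3 | h3
      · have := (g (i - 2) (by omega)).1
        rwa [Nat.sub_add_cancel h2] at this
      · have := (g (i - (q + 2 + 2)) (by omega)).2
        rwa [Nat.add_sub_cancel' h3] at this
    · exact fun g l hl => ⟨g _ (by omega), g _ (by omega)⟩
  · rw [ladder_odd, ladderOut_odd, actList_append, ← hs, actList_of_ne (q := c 0)]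
    swap
    · intro ρ hρ
      rcases List.mem_cons.1 hρ with rfl | hρ
      · exact hc _ (by omega) _ (by omega) (by omega)
      obtain ⟨j, hj, h⟩ := downRungs_tgt hρ
      rw [h]
      exact hc _ (by omega) _ (by omega) (by omega)
    rw [actList_cons]
    set ρ : Rung Q := ⟨c (q + 2 + 2 + q), c (q + 1), c (2 * q + 6), 1, 0⟩ with hρ
    have hs' : ∀ l < 2 * q + 7, l ≠ q + 2 + 2 + q → ρ.act s (c l) = s (c l) := fun l hl hl' =>
      Rung.act_of_ne (hc l hl _ (by omega) hl') s
    have ht : ρ.act s (c (q + 2 + 2 + q)) = s (c (q + 2 + 2 + q)) +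
        if s (c (2 * q + 6)) = 1 ∧ s (c (q + 1)) = 0 then 1 else 0 := Rung.act_tgt ρ s
    have hl : (∀ l ≤ q, ρ.act s (c l) = 0) ↔ ∀ l ≤ q, s (c l) = 0 :=
      forall₂_congr fun l hl => by rw [hs' l (by omega) (by omega)]
    have hclean' : ∀ j < q, (∀ l ≤ j, ρ.act s (c l) = 0) → ρ.act s (c (q + 2 + 2 + j)) = 1 := by
      intro j hj h
      rw [hs' _ (by omega) (by omega)]
      refine hclean j (by omega) fun l hl => ?_
      rw [← hs' l (by omega) (by omega)]
      exact h l hl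
    have key : (s (c 0) = 0 ∧ actList (downRungs c (q + 2) (c (q + 2 + 2 + q)) q) (ρ.act s)
        (downOut c (q + 2) (c (q + 2 + 2 + q)) q) = 0) ↔
        (∀ l < q + 2, s (c l) = 0) ∧ s (c (2 * q + 6)) = 1 := by
      have e : (∀ l < q + 2, s (c l) = 0) ↔ (∀ l ≤ q, s (c l) = 0) ∧ s (c (q + 1)) = 0 := by
        rw [Nat.forall_lt_succ_right]
        simp only [Nat.lt_succ_iff]
      have e0 : s (c 0) = 0 → (actList (downRungs c (q + 2) (c (q + 2 + 2 + q)) q) (ρ.act s)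
          (downOut c (q + 2) (c (q + 2 + 2 + q)) q) = 0 ↔
          (∀ l < q + 2, s (c l) = 0) ∧ s (c (2 * q + 6)) = 1) := by
        intro g0
        rw [downRungs_act hc (by omega) (by omega) (by omega) (by omega)
          (by rw [hs' 0 (by omega) (by omega), g0]) hclean', hl, ht, e, and_assoc, and_comm]
        refine and_congr_right fun hall => ?_
        rw [hclean q (by omega) hall]
        split_ifs with h' <;> simp <;> tauto
      constructor
      · rintro ⟨g0, g⟩
        exact (e0 g0).1 g
      · intro g
        exact ⟨g.1 0 (by omega), (e0 (g.1 0 (by omega))).2 g⟩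
    rw [key, flags _ le_rfl, hup _ (by omega) (by omega) (by omega)]
    constructor
    · rintro ⟨g, gu⟩ i hi
      rcases Nat.lt_or_ge i 2 with h2 | h2
      · interval_cases i <;> assumption
      rcases Nat.lt_or_ge i (q + 2 + 2) with h3 | h3
      · have := (g (i - 2) (by omega)).1
        rwa [Nat.sub_add_cancel h2] at this
      rcases Nat.lt_or_ge i (2 * q + 6) with h4 | h4
      · have := (g (i - (q + 2 + 2)) (by omega)).2
        rwa [Nat.add_sub_cancel' h3] at this
      · rwa [show i = 2 * q + 6 by omega]
    · exact fun g => ⟨fun l hl => ⟨g _ (by omega), g _ (by omega)⟩, g _ (by omega)⟩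

theorem ladder_mem {c : ℕ → Q} {n : ℕ} {ρ : Rung Q} (hρ : ρ ∈ ladder c n) :
    ∃ i j k, ρ.tgt = c i ∧ ρ.mid = c j ∧ ρ.side = c k := by
  have hd : ∀ p i j, ∀ ρ ∈ downRungs c p (c j) i,
      ∃ i j k, ρ.tgt = c i ∧ ρ.mid = c j ∧ ρ.side = c k := by
    intro p i
    induction i with
    | zero => simp [downRungs]
    | succ i ih =>
      intro j ρ hρ
      rcases List.mem_cons.1 hρ with rfl | hρ
      · exact ⟨_, _, _, rfl, rfl, rfl⟩
      · exact ih _ ρ hρ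
  rw [ladder, List.mem_append] at hρ
  rcases hρ with hρ | hρ
  · simp only [upRungs, List.mem_map] at hρ
    obtain ⟨i, -, rfl⟩ := hρ
    exact ⟨_, _, _, rfl, rfl, rfl⟩
  · split_ifs at hρ
    · exact hd _ _ _ _ hρ
    · rcases List.mem_cons.1 hρ with rfl | hρ
      · exact ⟨_, _, _, rfl, rfl, rfl⟩
      · exact hd _ _ _ _ hρ

theorem upRungs_length (c : ℕ → Q) (p j : ℕ) : (upRungs c p j).length = j := by simp [upRungs]

theorem downRungs_length (c : ℕ → Q) (p : ℕ) (y : Q) (i : ℕ) :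
    (downRungs c p y i).length = i := by
  induction i generalizing y with
  | zero => rfl
  | succ i ih => simp [downRungs, ih]

theorem ladder_length {c : ℕ → Q} {n : ℕ} (hn : 6 ≤ n) : (ladder c n).length = n - 4 := by
  obtain ⟨q, rfl | rfl⟩ : ∃ q, n = 2 * q + 6 ∨ n = 2 * q + 7 := ⟨(n - 6) / 2, by omega⟩
  · rw [ladder_even, List.length_append, upRungs_length, downRungs_length]; omega
  · rw [ladder_odd, List.length_append, List.length_cons, upRungs_length, downRungs_length]; omega

theorem ladderOK_upRungs {c : ℕ → Q} {n p : ℕ} (hc : ∀ i < n, ∀ j < n, i ≠ j → c i ≠ c j)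
    (hp : 2 * p + 2 ≤ n) : LadderOK (upRungs c p p) := by
  refine ⟨?_, ?_, ?_⟩
  · intro ρ hρ
    simp only [upRungs, List.mem_map, List.mem_range] at hρ
    obtain ⟨i, hi, rfl⟩ := hρ
    refine ⟨?_, ?_, ?_⟩ <;> exact hc _ (by omega) _ (by omega) (by omega)
  · rw [upRungs, List.isChain_map, List.isChain_range]
    intro m hm
    refine ⟨?_, ?_, ?_, ?_, ?_⟩ <;> exact hc _ (by omega) _ (by omega) (by omega)
  · rw [upRungs, List.pairwise_map]
    refine List.Pairwise.imp_of_mem ?_ List.pairwise_lt_range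
    intro a b ha hb hab
    rw [List.mem_range] at ha hb
    exact hc _ (by omega) _ (by omega) (by omega)

theorem ladderOK_downRungs {c : ℕ → Q} {n p i k : ℕ}
    (hc : ∀ i < n, ∀ j < n, i ≠ j → c i ≠ c j) (hp : 2 * p + 2 ≤ n) (hi : i + 1 < p)
    (hik : p + 2 + i ≤ k ∨ k < p + 2) (hki : i < k) (hkn : k < n) :
    LadderOK (downRungs c p (c k) i) := by
  induction i generalizing k with
  | zero => exact ⟨by simp [downRungs], by simp [downRungs], by simp [downRungs]⟩
  | succ i ih =>
    obtain ⟨g1, g2, g3⟩ := ih (k := p + 2 + i) (by omega) (by omega) (by omega) (by omega)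
    refine ⟨?_, ?_, ?_⟩
    · intro ρ hρ
      rcases List.mem_cons.1 hρ with rfl | hρ
      · refine ⟨?_, ?_, ?_⟩ <;> exact hc _ (by omega) _ (by omega) (by omega)
      · exact g1 ρ hρ
    · rw [downRungs, List.isChain_cons]
      refine ⟨?_, g2⟩
      intro ρ hρ
      cases i with
      | zero => simp [downRungs] at hρ
      | succ i =>
        simp only [downRungs, List.head?_cons, Option.mem_def, Option.some.injEq] at hρ
        subst hρ
        refine ⟨?_, ?_, ?_, ?_, ?_⟩ <;> exact hc _ (by omega) _ (by omega) (by omega)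
    · rw [downRungs, List.pairwise_cons]
      refine ⟨?_, g3⟩
      intro ρ hρ
      obtain ⟨j, hj, h⟩ := downRungs_tgt hρ
      rw [h]
      exact hc _ (by omega) _ (by omega) (by omega)

theorem LadderOK.append {rs rs' : List (Rung Q)} (h : LadderOK rs) (h' : LadderOK rs')
    (h1 : ∀ ρ ∈ rs.getLast?, ∀ ρ' ∈ rs'.head?, ρ.Follows ρ')
    (h2 : ∀ ρ ∈ rs, ∀ ρ' ∈ rs', ρ.tgt ≠ ρ'.tgt) : LadderOK (rs ++ rs') := by
  refine ⟨?_, List.isChain_append.2 ⟨h.chain, h'.chain, h1⟩,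
    List.pairwise_append.2 ⟨h.tgt, h'.tgt, h2⟩⟩
  intro ρ hρ
  rcases List.mem_append.1 hρ with hρ | hρ
  exacts [h.valid ρ hρ, h'.valid ρ hρ]

theorem ladderOK_ladder {c : ℕ → Q} {n : ℕ} (hn : 6 ≤ n)
    (hc : ∀ i < n, ∀ j < n, i ≠ j → c i ≠ c j) : LadderOK (ladder c n) := by
  have hlast : ∀ q ρ, ρ ∈ (upRungs c (q + 2) (q + 2)).getLast? →
      ρ = ⟨c (q + 1), c (q + 3), c (q + 2 + 2 + (q + 1)), 1, 1⟩ := by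
    intro q ρ hρ
    rw [upRungs, List.range_succ, List.map_append] at hρ
    simpa using hρ.symm
  have hmem : ∀ q ρ, ρ ∈ upRungs c (q + 2) (q + 2) → ∃ i < q + 2, ρ.tgt = c i := by
    intro q ρ hρ
    simp only [upRungs, List.mem_map, List.mem_range] at hρ
    obtain ⟨i, hi, rfl⟩ := hρ
    exact ⟨i, hi, rfl⟩
  obtain ⟨q, rfl | rfl⟩ : ∃ q, n = 2 * q + 6 ∨ n = 2 * q + 7 := ⟨(n - 6) / 2, by omega⟩
  · rw [ladder_even]
    refine (ladderOK_upRungs hc (by omega)).append (ladderOK_downRungs hc (by omega) (by omega)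
      (by omega) (by omega) (by omega)) ?_ ?_
    · intro ρ hρ ρ' hρ'
      rw [hlast q ρ hρ]
      cases q with
      | zero => simp [downRungs] at hρ'
      | succ q =>
        simp only [downRungs, List.head?_cons, Option.mem_def, Option.some.injEq] at hρ'
        subst hρ'
        refine ⟨?_, ?_, ?_, ?_, ?_⟩ <;> exact hc _ (by omega) _ (by omega) (by omega)
    · intro ρ hρ ρ' hρ'
      obtain ⟨i, hi, h⟩ := hmem q ρ hρ
      obtain ⟨j, hj, h'⟩ := downRungs_tgt hρ'
      rw [h, h']
      exact hc _ (by omega) _ (by omega) (by omega)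
  · rw [ladder_odd]
    have hd : LadderOK (downRungs c (q + 2) (c (q + 2 + 2 + q)) q) :=
      ladderOK_downRungs hc (by omega) (by omega) (by omega) (by omega) (by omega)
    have h1 : LadderOK [(⟨c (q + 2 + 2 + q), c (q + 1), c (2 * q + 6), 1, 0⟩ : Rung Q)] := by
      refine ⟨?_, by simp, by simp⟩
      intro ρ hρ
      rw [List.mem_singleton] at hρ
      subst hρ
      refine ⟨?_, ?_, ?_⟩ <;> exact hc _ (by omega) _ (by omega) (by omega)
    refine (ladderOK_upRungs hc (by omega)).append (h1.append hd ?_ ?_) ?_ ?_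
    · intro ρ hρ ρ' hρ'
      simp only [List.getLast?_singleton, Option.mem_def, Option.some.injEq] at hρ
      subst hρ
      cases q with
      | zero => simp [downRungs] at hρ'
      | succ q =>
        simp only [downRungs, List.head?_cons, Option.mem_def, Option.some.injEq] at hρ'
        subst hρ'
        refine ⟨?_, ?_, ?_, ?_, ?_⟩ <;> exact hc _ (by omega) _ (by omega) (by omega)
    · intro ρ hρ ρ' hρ'
      rw [List.mem_singleton] at hρ
      subst hρ
      obtain ⟨j, hj, h'⟩ := downRungs_tgt hρ'
      rw [h']
      exact hc _ (by omega) _ (by omega) (by omega)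
    · intro ρ hρ ρ' hρ'
      rw [hlast q ρ hρ]
      simp only [List.head?_cons, Option.mem_def,
        Option.some.injEq] at hρ'
      subst hρ'
      refine ⟨?_, ?_, ?_, ?_, ?_⟩ <;> exact hc _ (by omega) _ (by omega) (by omega)
    · intro ρ hρ ρ' hρ'
      obtain ⟨i, hi, h⟩ := hmem q ρ hρ
      rw [h]
      rcases List.mem_cons.1 hρ' with rfl | hρ'
      · exact hc _ (by omega) _ (by omega) (by omega)
      obtain ⟨j, hj, h'⟩ := downRungs_tgt hρ'
      rw [h']
      exact hc _ (by omega) _ (by omega) (by omega)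

end

noncomputable section

variable {Q : Type} [DecidableEq Q]

/-! ### CNOT trees -/

/-- The sign `(-1)^b` of a bit. -/
def sgn (b : Fin 2) : ℂ := if b = 1 then -1 else 1

theorem sgn_add_one (b : Fin 2) : sgn (b + 1) = -sgn b := by fin_cases b <;> simp [sgn]

/-- CNOT gates from every second qubit of a list to its predecessor. -/
def pairGates : List Q → List (Gate Q)
  | a :: b :: l => cx b a :: pairGates l
  | _ => []

/-- The targets of `pairGates`, and the last qubit if it has no partner. -/
def evens {Q : Type} : List Q → List Q
  | a :: _ :: l => a :: evens l
  | l => l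

/-- The time slots of a tree of CNOT gates of depth `d`, which collects the parity of a list of at
most `2 ^ d` qubits on its first qubit. -/
def fanSlots : ℕ → List Q → List (List (Gate Q))
  | 0, _ => []
  | d + 1, l => pairGates l :: fanSlots d (evens l)

theorem evens_sublist {Q : Type} (l : List Q) : (evens l).Sublist l := by
  induction l using evens.induct with
  | case1 a b l ih => exact (ih.cons b).cons_cons a
  | case2 l h => rw [evens.eq_2 l h]

theorem evens_cons {Q : Type} (a : Q) (l : List Q) : ∃ l', evens (a :: l) = a :: l' := by
  cases l with
  | nil => exact ⟨[], rfl⟩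
  | cons b l => exact ⟨_, rfl⟩

theorem evens_length {Q : Type} (l : List Q) : (evens l).length = (l.length + 1) / 2 := by
  induction l using evens.induct with
  | case1 a b l ih => simp only [evens, List.length_cons, ih]; omega
  | case2 l h =>
    match l, h with
    | [], _ => simp [evens]
    | [a], _ => simp [evens]
    | a :: b :: l, h => exact absurd rfl (h a b l)

theorem mem_pairGates {l : List Q} (hl : l.Nodup) {g : Gate Q} (hg : g ∈ pairGates l) :
    g.kind = .cnot ∧ ∀ q ∈ g.support, q ∈ l := by
  induction l using evens.induct with
  | case1 a b l ih =>
    have hab : b ≠ a := by rintro rfl; simp at hl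
    rcases List.mem_cons.1 hg with rfl | hg
    · exact ⟨kind_cx hab, by simp [support_cx hab]⟩
    · obtain ⟨h1, h2⟩ := ih (List.nodup_cons.1 (List.nodup_cons.1 hl).2).2 hg
      exact ⟨h1, fun q hq => by simp [h2 q hq]⟩
  | case2 l h => rw [pairGates.eq_2 l h] at hg; simp at hg

theorem pairGates_length (l : List Q) : (pairGates l).length = l.length / 2 := by
  induction l using evens.induct with
  | case1 a b l ih => simp only [pairGates, List.length_cons, ih]; omega
  | case2 l h =>
    match l, h with
    | [], _ => simp [pairGates]
    | [a], _ => simp [pairGates]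
    | a :: b :: l, h => exact absurd rfl (h a b l)

theorem slotOK_pairGates {l : List Q} (hl : l.Nodup) : SlotOK (pairGates l) := by
  refine ⟨?_, .cnot, fun g hg => (mem_pairGates hl hg).1⟩
  induction l using evens.induct with
  | case1 a b l ih =>
    have hab : b ≠ a := by rintro rfl; simp at hl
    obtain ⟨h1, h2⟩ := List.nodup_cons.1 hl
    obtain ⟨h3, h4⟩ := List.nodup_cons.1 h2
    rw [pairGates, List.pairwise_cons]
    refine ⟨fun g hg => ?_, ih h4⟩
    rw [support_cx hab, Finset.disjoint_left]
    intro q hq hq'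
    have := (mem_pairGates h4 hg).2 q hq'
    rcases Finset.mem_insert.1 hq with rfl | hq
    · exact h3 this
    · rw [Finset.mem_singleton.1 hq] at this
      exact h1 (by simp [this])
  | case2 l h => rw [pairGates.eq_2 l h]; exact List.Pairwise.nil

theorem slotOK_fanSlots {d : ℕ} {l : List Q} (hl : l.Nodup) : ∀ L ∈ fanSlots d l, SlotOK L := by
  induction d generalizing l with
  | zero => simp [fanSlots]
  | succ d ih =>
    intro L hL
    rcases List.mem_cons.1 hL with rfl | hL
    · exact slotOK_pairGates hl
    · exact ih ((evens_sublist l).nodup hl) L hL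

theorem fanSlots_cost_of_ne {d : ℕ} {l : List Q} (hl : l.Nodup) {k : Kind} (hk : k ≠ .cnot) :
    slotsCost (fanSlots d l) k = 0 ∧ slotsDepth (fanSlots d l) k = 0 := by
  induction d generalizing l with
  | zero => simp [fanSlots]
  | succ d ih =>
    have h : ∀ g ∈ pairGates l, ¬ g.kind = k := fun g hg => by
      rw [(mem_pairGates hl hg).1]; exact hk.symm
    obtain ⟨h1, h2⟩ := ih ((evens_sublist l).nodup hl)
    rw [fanSlots, slotsCost_cons, slotsDepth_cons, h1, h2]
    simpa using h

theorem fanSlots_depth_le (d : ℕ) (l : List Q) : slotsDepth (fanSlots d l) .cnot ≤ d := by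
  induction d generalizing l with
  | zero => simp [fanSlots]
  | succ d ih =>
    have := ih (evens l)
    rw [fanSlots, slotsDepth_cons]
    split_ifs <;> omega

theorem fanSlots_cost {d : ℕ} {a : Q} {l : List Q} (hl : (a :: l).Nodup)
    (hd : l.length + 1 ≤ 2 ^ d) : slotsCost (fanSlots d (a :: l)) .cnot = l.length := by
  induction d generalizing l with
  | zero =>
    have : l = [] := List.eq_nil_of_length_eq_zero (by simpa using hd)
    simp [fanSlots, this]
  | succ d ih =>
    obtain ⟨l', hl'⟩ := evens_cons a l
    have h1 := (evens_sublist (a :: l)).nodup hl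
    have h2 := evens_length (a :: l)
    have h3 : (pairGates (a :: l)).countP (fun g => decide (g.kind = .cnot)) =
        (l.length + 1) / 2 := by
      rw [List.countP_eq_length.2, pairGates_length, List.length_cons]
      intro g hg
      simp [(mem_pairGates hl hg).1]
    rw [hl'] at h1 h2
    simp only [List.length_cons] at h2
    rw [fanSlots, slotsCost_cons, hl', ih h1 (by rw [pow_succ] at hd; omega), h3]
    omega

variable [Fintype Q]

theorem cx_isMonomial {c t : Q} (h : c ≠ t) : IsMonomial (cx c t).op
    fun x => if x c = 1 then Function.update x t (x t + 1) else x := by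
  rw [op_cx h]
  refine isMonomial_muxOp (p := fun x => x c = 1) ?_ ?_
  · intro x b; simp [h]
  · intro x i j hij
    contrapose! hij
    unfold xPow
    split_ifs at hij ⊢ <;> fin_cases i <;> fin_cases j <;> simp [pauliX] at hij ⊢

/-- The parity of the qubits that remain is the parity of all qubits before. -/
theorem pairGates_isMonomial {l : List Q} (hl : l.Nodup) :
    ∃ π, IsMonomial (gatesOp (pairGates l)) π ∧ (∀ x, ∀ q ∉ l, π x q = x q) ∧
      ∀ x, ((evens l).map fun q => sgn (π x q)).prod = (l.map fun q => sgn (x q)).prod := by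
  induction l using evens.induct with
  | case1 a b l ih =>
    have hab : b ≠ a := by rintro rfl; simp at hl
    obtain ⟨h1, h2⟩ := List.nodup_cons.1 hl
    obtain ⟨h3, h4⟩ := List.nodup_cons.1 h2
    have ha : a ∉ l := fun h => h1 (by simp [h])
    obtain ⟨π, g1, g2, g3⟩ := ih h4
    refine ⟨π ∘ fun x => if x b = 1 then Function.update x a (x a + 1) else x, ?_, ?_, ?_⟩
    · rw [pairGates, gatesOp_cons]
      exact g1.mul (cx_isMonomial hab)
    · intro x q hq
      simp only [List.mem_cons, not_or] at hq
      rw [Function.comp_apply, g2 _ q hq.2.2]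
      split_ifs <;> simp [hq.1]
    · intro x
      have e : (l.map fun q => sgn ((if x b = 1 then Function.update x a (x a + 1) else x) q)) =
          l.map fun q => sgn (x q) := by
        refine List.map_congr_left fun q hq => ?_
        have : q ≠ a := by rintro rfl; exact ha hq
        split_ifs <;> simp [this]
      simp only [evens, List.map_cons, List.prod_cons, Function.comp_apply, g3, e, g2 _ a ha]
      rw [← mul_assoc]
      congr 1
      split_ifs with h
      · rw [Function.update_self, sgn_add_one, h]; simp [sgn]
      · simp [h, sgn]
  | case2 l h =>
    refine ⟨id, ?_, fun _ _ _ => rfl, fun x => by rw [evens.eq_2 l h]; rfl⟩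
    rw [pairGates.eq_2 l h, gatesOp_nil]
    exact isMonomial_one

/-- The CNOT tree writes the parity of its qubits onto the first one. -/
theorem fanSlots_isMonomial {d : ℕ} {a : Q} {l : List Q} (hl : (a :: l).Nodup)
    (hd : l.length + 1 ≤ 2 ^ d) :
    ∃ π, IsMonomial (gatesOp (fanSlots d (a :: l)).flatten) π ∧
      (∀ x, ∀ q ∉ a :: l, π x q = x q) ∧
      ∀ x, sgn (π x a) = ((a :: l).map fun q => sgn (x q)).prod := by
  induction d generalizing l with
  | zero =>
    have : l = [] := List.eq_nil_of_length_eq_zero (by simpa using hd)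
    subst this
    refine ⟨id, ?_, fun _ _ _ => rfl, fun x => by simp⟩
    simpa [fanSlots] using isMonomial_one
  | succ d ih =>
    obtain ⟨l', hl'⟩ := evens_cons a l
    have h1 := (evens_sublist (a :: l)).nodup hl
    have h2 := evens_length (a :: l)
    have h3 := (evens_sublist (a :: l)).subset
    obtain ⟨ρ, g1, g2, g3⟩ := pairGates_isMonomial hl
    rw [hl'] at h1 h2 h3 g3
    simp only [List.length_cons] at h2
    obtain ⟨π, f1, f2, f3⟩ := ih h1 (by rw [pow_succ] at hd; omega)
    refine ⟨π ∘ ρ, ?_, ?_, ?_⟩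
    · rw [fanSlots, hl', List.flatten_cons, gatesOp_append]
      exact f1.mul g1
    · intro x q hq
      rw [Function.comp_apply, f2 _ q fun h => hq (h3 h), g2 x q hq]
    · intro x
      rw [Function.comp_apply, f3, g3]

/-! ### Products of multiplexed operators on distinct qubits -/

/-- The product of the multiplexed operators that act on the qubits `q` of a list by `F q`. -/
def mtOp (F : Q → Basis Q → Matrix (Fin 2) (Fin 2) ℂ) (l : List Q) : Op Q :=
  (l.map fun q => muxOp (F q) q).prod

theorem mtOp_cons (F : Q → Basis Q → Matrix (Fin 2) (Fin 2) ℂ) (q : Q) (l : List Q) :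
    mtOp F (q :: l) = muxOp (F q) q * mtOp F l := by simp [mtOp]

theorem mtOp_congr {F G : Q → Basis Q → Matrix (Fin 2) (Fin 2) ℂ} {l : List Q}
    (h : ∀ q ∈ l, ∀ x, F q x = G q x) : mtOp F l = mtOp G l := by
  rw [mtOp, mtOp]
  congr 1
  exact List.map_congr_left fun q hq => by rw [funext (h q hq)]

/-- No `F q` with `q` in the list depends on a qubit of the list. -/
def IndepOn (F : Q → Basis Q → Matrix (Fin 2) (Fin 2) ℂ) (l : List Q) : Prop :=
  ∀ q ∈ l, ∀ t ∈ l, IndepOf (F q) t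

theorem IndepOn.tail {F : Q → Basis Q → Matrix (Fin 2) (Fin 2) ℂ} {q : Q} {l : List Q}
    (h : IndepOn F (q :: l)) : IndepOn F l :=
  fun q hq t ht => h q (by simp [hq]) t (by simp [ht])

theorem IndepOn.mul {F G : Q → Basis Q → Matrix (Fin 2) (Fin 2) ℂ} {l : List Q}
    (hF : IndepOn F l) (hG : IndepOn G l) : IndepOn (fun q x => F q x * G q x) l :=
  fun q hq t ht => (hF q hq t ht).comp₂ (hG q hq t ht) (· * ·)

theorem indepOn_const (A : Q → Matrix (Fin 2) (Fin 2) ℂ) (l : List Q) :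
    IndepOn (fun q _ => A q) l := fun _ _ _ _ => indepOf_const _ _

theorem mtOp_commute {F G : Q → Basis Q → Matrix (Fin 2) (Fin 2) ℂ} {q : Q} {l : List Q}
    (hl : (q :: l).Nodup) (hF : IndepOn F (q :: l)) (hG : IndepOn G (q :: l)) :
    Commute (mtOp F l) (muxOp (G q) q) := by
  refine Commute.list_prod_left _ _ fun a ha => ?_
  obtain ⟨t, ht, rfl⟩ := List.mem_map.1 ha
  refine muxOp_commute ?_ (hF t (by simp [ht]) q (by simp)) (hG q (by simp) t (by simp [ht]))
  rintro rfl
  exact (List.nodup_cons.1 hl).1 ht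

theorem mtOp_mul {F G : Q → Basis Q → Matrix (Fin 2) (Fin 2) ℂ} {l : List Q} (hl : l.Nodup)
    (hF : IndepOn F l) (hG : IndepOn G l) :
    mtOp F l * mtOp G l = mtOp (fun q x => F q x * G q x) l := by
  induction l with
  | nil => simp [mtOp]
  | cons q l ih =>
    have c := mtOp_commute hl hF hG
    rw [mtOp_cons, mtOp_cons, mtOp_cons, mul_assoc, ← mul_assoc (mtOp F l), c.eq, mul_assoc,
      ih (List.nodup_cons.1 hl).2 hF.tail hG.tail, ← mul_assoc,
      muxOp_mul_muxOp (hG q (by simp) q (by simp))]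

theorem mtOp_one (l : List Q) : mtOp (fun _ _ => (1 : Matrix (Fin 2) (Fin 2) ℂ)) l = 1 := by
  induction l with
  | nil => rfl
  | cons q l ih => rw [mtOp_cons, muxOp_one, ih, one_mul]

/-- A product of diagonal multiplexed operators is diagonal, whatever they depend on. -/
theorem mtOp_diagonal (g : Q → Basis Q → Fin 2 → ℂ) (l : List Q) :
    mtOp (fun q x => Matrix.diagonal (g q x)) l =
      Matrix.diagonal fun x => (l.map fun q => g q x (x q)).prod := by
  induction l with
  | nil => simp [mtOp]
  | cons q l ih => simp only [mtOp_cons, muxOp_diagonal, ih, Matrix.diagonal_mul_diagonal,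
      List.map_cons, List.prod_cons]

/-- One single-qubit gate on each qubit of a list. -/
theorem gatesOp_map {g : Q → Gate Q} {A : Q → Matrix (Fin 2) (Fin 2) ℂ}
    (h : ∀ q, (g q).op = controlled ∅ (A q) q) {l : List Q} (hl : l.Nodup) :
    gatesOp (l.map g) = mtOp (fun q _ => A q) l := by
  induction l with
  | nil => simp [mtOp]
  | cons q l ih =>
    rw [List.map_cons, gatesOp_cons, ih (List.nodup_cons.1 hl).2, mtOp_cons, h, controlled_empty]
    exact (mtOp_commute (F := fun q _ => A q) (G := fun q _ => A q) hl (indepOn_const A _)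
      (indepOn_const A _)).eq

end

noncomputable section

variable {Q : Type} [DecidableEq Q]

/-! ### Controlled phases on several targets -/

/-- The time slots that apply, up to a phase, the Pauli matrix `Z` to all the qubits `a :: ts` if the
qubits `s` and `m` have the values `ps` and `pm`. -/
def phaseSlots (s m : Q) (ps pm : Fin 2) (d : ℕ) (a : Q) (ts : List Q) :
    List (List (Gate Q)) :=
  fanSlots d (a :: ts) ++ ((ccGates s m ps pm a ++ [cx m a]).map ([·]) ++
    invSlots (fanSlots d (a :: ts)))

/-- The action on the qubit `q` of a conditional Pauli `Z` on several qubits. The phases `κ₁` and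
`κ₀`, for a true and a false condition, are attributed to the qubit `a`. -/
def condZ (P : Basis Q → Prop) [DecidablePred P] (κ₁ κ₀ : ℂ) (a q : Q) (x : Basis Q) :
    Matrix (Fin 2) (Fin 2) ℂ :=
  (if q = a then if P x then κ₁ else κ₀ else 1) • if P x then pauliZ else 1

theorem flatten_map_singleton {α : Type*} (l : List α) : (l.map ([·])).flatten = l := by
  induction l with
  | nil => rfl
  | cons a l ih => simp [ih]

variable [Fintype Q]

theorem pauliZ_eq_diagonal : pauliZ = Matrix.diagonal sgn := by
  ext i j; fin_cases i <;> fin_cases j <;> simp [pauliZ, sgn]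

theorem pauliZ_mul_self : pauliZ * pauliZ = 1 := by simp [pauliZ, Matrix.one_fin_two]

theorem indepOn_condZ {P : Basis Q → Prop} [DecidablePred P] {l : List Q}
    (h : ∀ t ∈ l, IndepOf P t) (κ₁ κ₀ : ℂ) (a : Q) : IndepOn (condZ P κ₁ κ₀ a) l := by
  intro q _ t ht x b
  simp only [condZ, h t ht x b]

theorem mtOp_condZ (P : Basis Q → Prop) [DecidablePred P] (κ₁ κ₀ : ℂ) {a : Q} {ts : List Q}
    (hl : (a :: ts).Nodup) : mtOp (condZ P κ₁ κ₀ a) (a :: ts) = Matrix.diagonal fun x =>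
      if P x then κ₁ * ((a :: ts).map fun q => sgn (x q)).prod else κ₀ := by
  have e : condZ P κ₁ κ₀ a = fun q x => Matrix.diagonal fun i =>
      (if q = a then if P x then κ₁ else κ₀ else 1) * if P x then sgn i else 1 := by
    funext q x
    rw [condZ]
    by_cases h : P x
    · simp only [h, if_true, pauliZ_eq_diagonal, ← Matrix.diagonal_smul]; rfl
    · simp only [h, if_false, ← Matrix.diagonal_one, ← Matrix.diagonal_smul]; rfl
  rw [e, mtOp_diagonal]
  congr 1
  funext x
  have h : ∀ q ∈ ts, ((if q = a then if P x then κ₁ else κ₀ else 1) *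
      if P x then sgn (x q) else 1) = if P x then sgn (x q) else 1 := by
    intro q hq
    have : q ≠ a := by rintro rfl; exact (List.nodup_cons.1 hl).1 hq
    simp [this]
  rw [List.map_cons, List.prod_cons, List.map_congr_left h]
  by_cases hP : P x <;> simp [hP, mul_assoc]

/-- Inverting the phases inverts a conditional `Z`. -/
theorem mtOp_condZ_inv {P : Basis Q → Prop} [DecidablePred P] {κ₁ κ₀ : ℂ} {a : Q} {ts : List Q}
    (hl : (a :: ts).Nodup) (h1 : κ₁ ≠ 0) (h0 : κ₀ ≠ 0) :
    mtOp (condZ P κ₁ κ₀ a) (a :: ts) * mtOp (condZ P κ₁⁻¹ κ₀⁻¹ a) (a :: ts) = 1 := by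
  rw [mtOp_condZ _ _ _ hl, mtOp_condZ _ _ _ hl, Matrix.diagonal_mul_diagonal,
    ← Matrix.diagonal_one]
  congr 1
  funext x
  have hs : ((a :: ts).map fun q => sgn (x q)).prod * ((a :: ts).map fun q => sgn (x q)).prod
      = 1 := by
    rw [← List.prod_map_mul]
    apply List.prod_eq_one
    intro z hz
    obtain ⟨q, -, rfl⟩ := List.mem_map.1 hz
    rw [sgn]; split_ifs <;> simp
  split_ifs
  · rw [mul_mul_mul_comm, hs, mul_inv_cancel₀ h1, one_mul]
  · rw [mul_inv_cancel₀ h0]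

/-- Conjugation by a permutation of the basis states that fixes the targets replaces the condition by
its value after the permutation. -/
theorem IsMonomial.conj_condZ {R R' : Op Q} {π : Basis Q → Basis Q} (hR : IsMonomial R π)
    (h : R' * R = 1) (P : Basis Q → Prop) [DecidablePred P] (κ₁ κ₀ : ℂ) {a : Q} {ts : List Q}
    (hl : (a :: ts).Nodup) (hπ : ∀ x, ∀ q ∈ a :: ts, π x q = x q) :
    R' * mtOp (condZ P κ₁ κ₀ a) (a :: ts) * R =
      mtOp (condZ (fun x => P (π x)) κ₁ κ₀ a) (a :: ts) := by
  rw [mtOp_condZ _ _ _ hl, mtOp_condZ _ _ _ hl, hR.conj_diagonal h]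
  congr 1
  funext x
  rw [Function.comp_apply, List.map_congr_left fun q hq => by rw [hπ x q hq]]

theorem gatesOp_phaseSlots {s m a : Q} {ts : List Q} {d : ℕ} (hl : (a :: ts).Nodup)
    (hd : ts.length + 1 ≤ 2 ^ d) (hs : s ∉ a :: ts) (hm : m ∉ a :: ts) (ps pm : Fin 2) :
    gatesOp (phaseSlots s m ps pm d a ts).flatten = mtOp (condZ (fun x => x s = ps ∧ x m = pm)
      (-Complex.I * idlePhase ps pm) (idlePhase ps pm) a) (a :: ts) := by
  obtain ⟨π, h1, h2, h3⟩ := fanSlots_isMonomial hl hd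
  have hsa : s ≠ a := by rintro rfl; simp at hs
  have hma : m ≠ a := by rintro rfl; simp at hm
  rw [phaseSlots, List.flatten_append, List.flatten_append, flatten_map_singleton,
    flatten_invSlots, gatesOp_append, gatesOp_append, gatesOp_ccGates_cx hsa hma]
  have e : (fun x : Basis Q => ccMat ps pm (x s) (x m)) = fun x => Matrix.diagonal fun i =>
      if x s = ps ∧ x m = pm then -Complex.I * idlePhase ps pm * sgn i else idlePhase ps pm := by
    funext x
    rw [ccMat]
    split_ifs
    · rw [pauliZ_eq_diagonal, ← Matrix.diagonal_smul]; rfl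
    · rw [← Matrix.diagonal_one, ← Matrix.diagonal_smul]
      congr 1
      funext i
      simp
  rw [e, muxOp_diagonal (fun (x : Basis Q) i => if x s = ps ∧ x m = pm then
    -Complex.I * idlePhase ps pm * sgn i else idlePhase ps pm),
    h1.conj_diagonal (gatesOp_invGates_mul _), mtOp_condZ _ _ _ hl]
  congr 1
  funext x
  simp only [Function.comp_apply, h2 x s hs, h2 x m hm, h3]

theorem gatesOp_invGates_eq {l : List (Gate Q)} {S : Op Q} (h : gatesOp l * S = 1) :
    gatesOp (invGates l) = S := by
  calc gatesOp (invGates l) = gatesOp (invGates l) * (gatesOp l * S) := by rw [h, mul_one]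
    _ = S := by rw [← mul_assoc, gatesOp_invGates_mul, one_mul]

theorem gatesOp_inv_phaseSlots {s m a : Q} {ts : List Q} {d : ℕ} (hl : (a :: ts).Nodup)
    (hd : ts.length + 1 ≤ 2 ^ d) (hs : s ∉ a :: ts) (hm : m ∉ a :: ts) (ps pm : Fin 2) :
    gatesOp (invSlots (phaseSlots s m ps pm d a ts)).flatten =
      mtOp (condZ (fun x => x s = ps ∧ x m = pm)
        (-Complex.I * idlePhase ps pm)⁻¹ (idlePhase ps pm)⁻¹ a) (a :: ts) := by
  rw [flatten_invSlots]
  apply gatesOp_invGates_eq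
  have h0 := idlePhase_ne_zero ps pm
  rw [gatesOp_phaseSlots hl hd hs hm, mtOp_condZ_inv hl (by simp [h0]) h0]

/-! ### The commutator of two conditional phases -/

theorem pauliZ_mul_rotX (φ : ℝ) : pauliZ * rotX φ = rotX (-φ) * pauliZ := by
  ext i j
  fin_cases i <;> fin_cases j <;>
    simp [pauliZ, rotX, Matrix.mul_apply, Fin.sum_univ_two, neg_div]

theorem hadamard_rotX_hadamard (φ : ℝ) : hadamard * rotX φ * hadamard = rotZ φ := by
  have h : ((Real.sqrt 2 : ℝ) : ℂ) * ((Real.sqrt 2 : ℝ) : ℂ) = 2 := by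
    rw [← Complex.ofReal_mul, Real.mul_self_sqrt (by norm_num)]; norm_num
  have h' : ((Real.sqrt 2 : ℝ) : ℂ)⁻¹ * ((Real.sqrt 2 : ℝ) : ℂ)⁻¹ = 2⁻¹ := by
    rw [← mul_inv, h]
  have e1 : Complex.exp (Complex.I * (φ / 2)) =
      Complex.cos (φ / 2) + Complex.sin (φ / 2) * Complex.I := by
    rw [mul_comm, Complex.exp_mul_I]
  have e2 : Complex.exp (-(Complex.I * (φ / 2))) =
      Complex.cos (φ / 2) - Complex.sin (φ / 2) * Complex.I := by
    rw [mul_comm, ← neg_mul, Complex.exp_mul_I, Complex.cos_neg, Complex.sin_neg]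
    ring
  rw [hadamard, Matrix.smul_mul, Matrix.smul_mul, Matrix.mul_smul, smul_smul, h']
  ext i j
  fin_cases i <;> fin_cases j <;>
    simp [rotX, rotZ, e1, e2] <;> ring

/-- The group commutator of conditional `Z` matrices and rotations about an orthogonal axis, with
the first of four rotations omitted. -/
theorem commutator_rotX (P₁ P₂ : Prop) [Decidable P₁] [Decidable P₂] (φ : ℝ) :
    (if P₁ then pauliZ else 1) * rotX (-φ) * (if P₂ then pauliZ else 1) * rotX φ *
      (if P₁ then pauliZ else 1) * rotX (-φ) * (if P₂ then pauliZ else 1) =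
      if P₁ ∧ P₂ then rotX (3 * φ) else rotX (-φ) := by
  by_cases h1 : P₁ <;> by_cases h2 : P₂ <;>
    simp only [h1, h2, if_true, if_false, and_self, and_true, and_false, one_mul, mul_one]
  · calc _ = (pauliZ * rotX (-φ)) * pauliZ * rotX φ * ((pauliZ * rotX (-φ)) * pauliZ) := by
          simp only [mul_assoc]
      _ = rotX φ * (pauliZ * pauliZ) * rotX φ * (rotX φ * (pauliZ * pauliZ)) := by
          rw [pauliZ_mul_rotX, neg_neg]
          simp only [mul_assoc]
      _ = rotX (3 * φ) := by
          rw [pauliZ_mul_self, mul_one, rotX_mul, rotX_mul]; congr 1; ring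
  · rw [mul_assoc pauliZ, rotX_mul, neg_add_cancel, rotX_zero, mul_one, pauliZ_mul_self, one_mul]
  · rw [mul_assoc (rotX (-φ) * pauliZ), rotX_mul, add_neg_cancel, rotX_zero, mul_one, mul_assoc,
      pauliZ_mul_self, mul_one]
  · rw [rotX_mul, neg_add_cancel, rotX_zero, one_mul]

/-! ### The circuit for given qubits, ladder and angles -/

/-- The rotations of the circuit: a time slot for the gate `g q` on each qubit `q` of a list. -/
def rotSlots {Q : Type} (g : Q → Gate Q) (l : List Q) : List (List (Gate Q)) := l.map fun q => [g q]

theorem flatten_rotSlots {Q : Type} (g : Q → Gate Q) (l : List Q) :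
    (rotSlots g l).flatten = l.map g := by
  induction l with
  | nil => rfl
  | cons q l ih => rw [rotSlots, List.map_cons, List.flatten_cons, ← rotSlots, ih]; rfl

/-- The time slots of the circuit with the ladder `ρ :: rs`, whose result is held by the qubits
`s` and `y`; `s` and `m` are the controls that are not checked by the ladder. The angles `α`, `β`
give the rotation axes of the targets `ts`, and `φ` is a quarter of the rotation angles. The ancilla
qubit `a` is rotated about the `z`-axis, and its rotation by `φ a` before the first ladder is
omitted. -/
def mainSlots (ρ : Rung Q) (rs : List (Rung Q)) (s m y : Q) (d : ℕ) (a : Q) (ts : List Q)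
    (α β φ : Q → ℝ) : List (List (Gate Q)) :=
  rotSlots (fun q => .Rx (-α q) q) ts ++ (rotSlots (fun q => .Rz (-β q) q) ts ++
  (rotSlots (fun q => .Rx (φ q) q) ts ++ (ladderSlots [.H a] ρ rs ++
  (phaseSlots s y 0 0 d a ts ++ (invSlots (ladderSlots [] ρ rs) ++
  (rotSlots (fun q => .Rx (-φ q) q) (a :: ts) ++ (phaseSlots s m 1 1 d a ts ++
  (rotSlots (fun q => .Rx (φ q) q) (a :: ts) ++ (ladderSlots [] ρ rs ++
  (invSlots (phaseSlots s y 0 0 d a ts) ++ (invSlots (ladderSlots [] ρ rs) ++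
  (rotSlots (fun q => .Rx (-φ q) q) (a :: ts) ++ (invSlots (phaseSlots s m 1 1 d a ts) ++
  ([[.H a]] ++ (rotSlots (fun q => .Rz (β q) q) ts ++
  rotSlots (fun q => .Rx (α q) q) ts)))))))))))))))

/-- The factor on the right is what the rotation omitted on the qubit `a` leaves behind. -/
theorem gatesOp_mainSlots {ρ : Rung Q} {rs : List (Rung Q)} {s m y : Q} {d : ℕ} {a : Q}
    {ts : List Q} (α β φ : Q → ℝ) (hl : (a :: ts).Nodup) (hd : ts.length + 1 ≤ 2 ^ d)
    (hρ : LadderOK (ρ :: rs))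
    (hr : ∀ t ∈ a :: ts, ∀ ρ' ∈ ρ :: rs, t ≠ ρ'.tgt ∧ t ≠ ρ'.mid ∧ t ≠ ρ'.side)
    (hs : s ∉ a :: ts) (hm : m ∉ a :: ts) (hy : y ∉ a :: ts) :
    gatesOp (mainSlots ρ rs s m y d a ts α β φ).flatten =
      mtOp (fun q x => if (x s = 1 ∧ x m = 1) ∧
          (actList (ρ :: rs) x s = 0 ∧ actList (ρ :: rs) x y = 0) then
          if q = a then rotZ (4 * φ q)
          else rotX (α q) * rotZ (β q) * rotX (4 * φ q) * rotZ (-β q) * rotX (-α q)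
        else 1) (a :: ts) * mtOp (fun q _ => if q = a then rotZ (-φ q) else 1) (a :: ts) := by
  have ht := (List.nodup_cons.1 hl).2
  have hX : ∀ (f : Q → ℝ) (l : List Q), l.Nodup →
      gatesOp (rotSlots (fun q => .Rx (f q) q) l).flatten = mtOp (fun q _ => rotX (f q)) l :=
    fun f l hl => by rw [flatten_rotSlots, gatesOp_map (fun q => rfl) hl]
  have hZ : ∀ (f : Q → ℝ) (l : List Q), l.Nodup →
      gatesOp (rotSlots (fun q => .Rz (f q) q) l).flatten = mtOp (fun q _ => rotZ (f q)) l :=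
    fun f l hl => by rw [flatten_rotSlots, gatesOp_map (fun q => rfl) hl]
  have hLam : gatesOp (ladderSlots [] ρ rs).flatten = gatesOp (ladderGates (ρ :: rs)) := by
    rw [gatesOp_ladderSlots _ hρ, gatesOp_nil, mul_one]
  have hinv : gatesOp (invSlots (ladderSlots [] ρ rs)).flatten *
      gatesOp (ladderGates (ρ :: rs)) = 1 := by
    rw [flatten_invSlots, ← hLam, gatesOp_invGates_mul]
  have hmono := ladder_isMonomial hρ.valid
  have hact : ∀ x, ∀ q ∈ a :: ts, actList (ρ :: rs) x q = x q := fun x q hq =>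
    actList_of_ne (fun ρ' h' => (hr q hq ρ' h').1) x
  have i1 : ∀ t ∈ a :: ts, IndepOf (fun x : Basis Q => x s = 1 ∧ x m = 1) t := by
    intro t ht x b
    have h1 : s ≠ t := by rintro rfl; exact hs ht
    have h2 : m ≠ t := by rintro rfl; exact hm ht
    simp [h1, h2]
  have i2 : ∀ t ∈ a :: ts, IndepOf (fun x : Basis Q =>
      actList (ρ :: rs) x s = 0 ∧ actList (ρ :: rs) x y = 0) t := by
    intro t ht x b
    have h1 : s ≠ t := by rintro rfl; exact hs ht
    have h2 : y ≠ t := by rintro rfl; exact hy ht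
    have h := actList_congr (hr t ht) (x := Function.update x t b) (y := x)
      (fun q hq => by simp [hq])
    simp only [h s h1, h y h2]
  simp only [mainSlots, List.flatten_append, gatesOp_append, hX _ _ ht, hZ _ _ ht, hX _ _ hl,
    gatesOp_phaseSlots hl hd hs hm, gatesOp_phaseSlots hl hd hs hy,
    gatesOp_inv_phaseSlots hl hd hs hm, gatesOp_inv_phaseSlots hl hd hs hy, hLam,
    gatesOp_ladderSlots [.H a] hρ, List.flatten_singleton, gatesOp_singleton, op_H]
  set κ : ℂ := idlePhase 0 0
  set κ' : ℂ := idlePhase 1 1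
  have hκ : κ ≠ 0 := idlePhase_ne_zero _ _
  have hκ' : κ' ≠ 0 := idlePhase_ne_zero _ _
  -- conjugation by the ladder evaluates the condition on the result of the ladder
  have j1 := hmono.conj_condZ hinv (fun x => x s = 0 ∧ x y = 0) (-Complex.I * κ) κ hl hact
  have j2 := hmono.conj_condZ hinv (fun x => x s = 0 ∧ x y = 0) (-Complex.I * κ)⁻¹ κ⁻¹ hl hact
  have k1 : ∀ A B C : Q → Matrix (Fin 2) (Fin 2) ℂ,
      mtOp (fun q _ => A q) ts * mtOp (fun q _ => B q) ts * mtOp (fun q _ => C q) ts =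
        mtOp (fun q _ => A q * B q * C q) ts := by
    intro A B C
    rw [mtOp_mul ht (indepOn_const A _) (indepOn_const B _),
      mtOp_mul ht (indepOn_const (fun q => A q * B q) _) (indepOn_const C _)]
  have k2 := k1 (fun q => rotX (φ q)) (fun q => rotZ (-β q)) (fun q => rotX (-α q))
  have k3 : mtOp (fun q _ => rotX (α q)) ts * mtOp (fun q _ => rotZ (β q)) ts =
      mtOp (fun q _ => rotX (α q) * rotZ (β q)) ts :=
    mtOp_mul ht (indepOn_const (fun q => rotX (α q)) _) (indepOn_const (fun q => rotZ (β q)) _)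
  have k4 : ∀ A : Q → Matrix (Fin 2) (Fin 2) ℂ,
      muxOp (fun _ => hadamard) a * mtOp (fun q _ => A q) ts =
        mtOp (fun q _ => if q = a then hadamard else A q) (a :: ts) := by
    intro A
    rw [mtOp_cons, if_pos rfl]
    congr 1
    refine mtOp_congr fun q hq x => ?_
    have : q ≠ a := by rintro rfl; exact (List.nodup_cons.1 hl).1 hq
    rw [if_neg this]
  have k5 : ∀ A : Q → Matrix (Fin 2) (Fin 2) ℂ,
      mtOp (fun q _ => A q) ts * muxOp (fun _ => hadamard) a =
        mtOp (fun q _ => if q = a then hadamard else A q) (a :: ts) := by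
    intro A
    rw [← k4]
    have := mtOp_commute (F := fun q _ => if q = a then hadamard else A q)
      (G := fun q _ => if q = a then hadamard else A q) hl
      (indepOn_const (fun q => if q = a then hadamard else A q) _)
      (indepOn_const (fun q => if q = a then hadamard else A q) _)
    have e : mtOp (fun q _ => if q = a then hadamard else A q) ts = mtOp (fun q _ => A q) ts := by
      refine mtOp_congr fun q hq x => ?_
      have : q ≠ a := by rintro rfl; exact (List.nodup_cons.1 hl).1 hq
      rw [if_neg this]
    rw [e, if_pos rfl] at this
    exact this.eq
  -- the basis changes, with the Hadamard gates of the ancilla qubit among them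
  set A₁ := fun q => if q = a then hadamard else rotX (α q) * rotZ (β q)
  set A₂ := fun q => if q = a then hadamard else rotX (φ q) * rotZ (-β q) * rotX (-α q)
  set P₁ := fun x : Basis Q => x s = 1 ∧ x m = 1
  set P₂ := fun x : Basis Q => actList (ρ :: rs) x s = 0 ∧ actList (ρ :: rs) x y = 0
  have n1 := indepOn_const A₁ (a :: ts)
  have n2 := indepOn_const A₂ (a :: ts)
  have n3 := indepOn_const (fun q => rotX (φ q)) (a :: ts)
  have n4 := indepOn_const (fun q => rotX (-φ q)) (a :: ts)
  have n5 := indepOn_condZ i1 (-Complex.I * κ') κ' a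
  have n6 := indepOn_condZ i1 (-Complex.I * κ')⁻¹ κ'⁻¹ a
  have n7 := indepOn_condZ i2 (-Complex.I * κ) κ a
  have n8 := indepOn_condZ i2 (-Complex.I * κ)⁻¹ κ⁻¹ a
  -- the circuit as a product of operators that act on each target separately
  trans mtOp (fun q _ => A₁ q) (a :: ts) * mtOp (condZ P₁ (-Complex.I * κ')⁻¹ κ'⁻¹ a) (a :: ts) *
      mtOp (fun q _ => rotX (-φ q)) (a :: ts) *
      mtOp (condZ P₂ (-Complex.I * κ)⁻¹ κ⁻¹ a) (a :: ts) *
      mtOp (fun q _ => rotX (φ q)) (a :: ts) *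
      mtOp (condZ P₁ (-Complex.I * κ') κ' a) (a :: ts) *
      mtOp (fun q _ => rotX (-φ q)) (a :: ts) *
      mtOp (condZ P₂ (-Complex.I * κ) κ a) (a :: ts) * mtOp (fun q _ => A₂ q) (a :: ts)
  · have l1 : mtOp (fun q _ => A₁ q) (a :: ts) = mtOp (fun q _ => rotX (α q)) ts *
        mtOp (fun q _ => rotZ (β q)) ts * muxOp (fun _ => hadamard) a := by
      rw [k3, k5]
    have l2 : mtOp (fun q _ => A₂ q) (a :: ts) = muxOp (fun _ => hadamard) a *
        (mtOp (fun q _ => rotX (φ q)) ts * mtOp (fun q _ => rotZ (-β q)) ts *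
          mtOp (fun q _ => rotX (-α q)) ts) := by
      rw [k2, k4]
    rw [l1, l2, ← j1, ← j2]
    simp only [mul_assoc]
    rfl
  rw [mtOp_mul hl n1 n6, mtOp_mul hl (n1.mul n6) n4, mtOp_mul hl ((n1.mul n6).mul n4) n8,
    mtOp_mul hl (((n1.mul n6).mul n4).mul n8) n3,
    mtOp_mul hl ((((n1.mul n6).mul n4).mul n8).mul n3) n5,
    mtOp_mul hl (((((n1.mul n6).mul n4).mul n8).mul n3).mul n5) n4,
    mtOp_mul hl ((((((n1.mul n6).mul n4).mul n8).mul n3).mul n5).mul n4) n7,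
    mtOp_mul hl (((((((n1.mul n6).mul n4).mul n8).mul n3).mul n5).mul n4).mul n7) n2, mtOp_mul hl]
  rotate_left
  · intro q hq t ht x b
    have h1 : (Function.update x t b s = 1 ∧ Function.update x t b m = 1) = (x s = 1 ∧ x m = 1) :=
      i1 t ht x b
    have h2 : (actList (ρ :: rs) (Function.update x t b) s = 0 ∧
        actList (ρ :: rs) (Function.update x t b) y = 0) =
        (actList (ρ :: rs) x s = 0 ∧ actList (ρ :: rs) x y = 0) := i2 t ht x b
    simp only [h1, h2]
  · exact indepOn_const (fun q => if q = a then rotZ (-φ q) else 1) _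
  -- on each target, the product is the commutator, conjugated by the basis change
  refine mtOp_congr fun q hq x => ?_
  have hcomm := commutator_rotX (P₁ x) (P₂ x) (φ q)
  by_cases hqa : q = a
  · have hsc : (if P₁ x then (-Complex.I * κ')⁻¹ else κ'⁻¹) *
        (if P₂ x then (-Complex.I * κ)⁻¹ else κ⁻¹) * (if P₁ x then -Complex.I * κ' else κ') *
        (if P₂ x then -Complex.I * κ else κ) = 1 := by
      by_cases h1 : P₁ x <;> by_cases h2 : P₂ x <;> simp only [h1, h2, if_true, if_false] <;>
        field_simp
    -- the relative phases, all attributed to the qubit `a`, cancel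
    have hgen : ∀ (u₁ u₂ u₃ u₄ : ℂ) (A B C D E F G K : Matrix (Fin 2) (Fin 2) ℂ),
        u₁ * u₂ * u₃ * u₄ = 1 → A * (u₁ • B) * C * (u₂ • D) * E * (u₃ • F) * G * (u₄ • K) * A =
          A * (B * C * D * E * F * G * K) * A := by
      intro u₁ u₂ u₃ u₄ A B C D E F G K hu
      simp only [smul_mul_assoc, mul_smul_comm, smul_smul, ← mul_assoc] at hu ⊢
      rw [show u₄ * u₃ * u₂ * u₁ = 1 by rw [← hu]; ring, one_smul]
    simp only [A₁, A₂, condZ, if_pos hqa]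
    rw [hgen _ _ _ _ _ _ _ _ _ _ _ _ hsc, hcomm]
    by_cases h : P₁ x ∧ P₂ x
    · rw [if_pos h, if_pos (show (x s = 1 ∧ x m = 1) ∧ _ from h), hadamard_rotX_hadamard, rotZ_mul]
      congr 1
      ring
    · rw [if_neg h, if_neg (show ¬((x s = 1 ∧ x m = 1) ∧ _) from h), hadamard_rotX_hadamard,
        one_mul]
  · simp only [A₁, A₂, condZ, hqa, if_false, one_smul, mul_one]
    trans rotX (α q) * rotZ (β q) * (if P₁ x ∧ P₂ x then rotX (3 * φ q) else rotX (-φ q)) *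
      (rotX (φ q) * rotZ (-β q) * rotX (-α q))
    · rw [← hcomm]
      simp only [mul_assoc]
    · by_cases h : P₁ x ∧ P₂ x
      · rw [if_pos h, if_pos (show (x s = 1 ∧ x m = 1) ∧ _ from h),
          show 4 * φ q = 3 * φ q + φ q by ring, ← rotX_mul (3 * φ q)]
        simp only [mul_assoc]
      · rw [if_neg h, if_neg (show ¬((x s = 1 ∧ x m = 1) ∧ _) from h)]
        have e1 : rotX (-φ q) * (rotX (φ q) * rotZ (-β q) * rotX (-α q)) =
            rotZ (-β q) * rotX (-α q) := by
          rw [mul_assoc, ← mul_assoc, rotX_mul, neg_add_cancel, rotX_zero, one_mul]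
        rw [mul_assoc, e1, mul_assoc, ← mul_assoc (rotZ (β q)), rotZ_mul, add_neg_cancel, rotZ_zero,
          one_mul, rotX_mul, add_neg_cancel, rotX_zero]

end

noncomputable section

variable {Q : Type} [DecidableEq Q]

/-! ### Validity, costs and depths of the circuit -/

theorem slotOK_rotSlots {Q : Type} [DecidableEq Q] (g : Q → Gate Q) (l : List Q) :
    ∀ L ∈ rotSlots g l, SlotOK L := by
  intro L hL
  obtain ⟨q, -, rfl⟩ := List.mem_map.1 hL
  exact slotOK_singleton _

theorem forall_mem_append {α : Type*} {p : α → Prop} {l l' : List α} (h : ∀ x ∈ l, p x)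
    (h' : ∀ x ∈ l', p x) : ∀ x ∈ l ++ l', p x :=
  List.forall_mem_append.2 ⟨h, h'⟩

theorem slotOK_phaseSlots {s m a : Q} {ps pm : Fin 2} {d : ℕ} {ts : List Q}
    (hl : (a :: ts).Nodup) : ∀ L ∈ phaseSlots s m ps pm d a ts, SlotOK L := by
  refine forall_mem_append (slotOK_fanSlots hl) (forall_mem_append ?_
    (slotOK_invSlots (slotOK_fanSlots hl)))
  intro L hL
  obtain ⟨q, -, rfl⟩ := List.mem_map.1 hL
  exact slotOK_singleton _

theorem slotOK_mainSlots {ρ : Rung Q} {rs : List (Rung Q)} {s m y : Q} {d : ℕ} {a : Q}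
    {ts : List Q} (α β φ : Q → ℝ) (hl : (a :: ts).Nodup) (hρ : LadderOK (ρ :: rs))
    (ha : ∀ ρ' ∈ ρ :: rs, a ≠ ρ'.tgt) :
    ∀ L ∈ mainSlots ρ rs s m y d a ts α β φ, SlotOK L := by
  have h0 : SlotOK (.H ρ.tgt :: headH rs) := slotOK_H_headH (List.pairwise_cons.1 hρ.tgt).1
  have hL : ∀ L ∈ ladderSlots [] ρ rs, SlotOK L := slotOK_ladderSlots hρ h0
  have hL' : ∀ L ∈ ladderSlots [.H a] ρ rs, SlotOK L := by
    refine slotOK_ladderSlots hρ ⟨?_, .h, ?_⟩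
    · rw [List.singleton_append, List.pairwise_cons]
      refine ⟨?_, h0.1⟩
      intro g hg
      rcases List.mem_cons.1 hg with rfl | hg
      · simpa using ha ρ (by simp)
      · obtain ⟨ρ', h', -, rfl⟩ := mem_headH hg
        simpa using ha ρ' (by simp [h'])
    · intro g hg
      simp only [List.singleton_append, List.mem_cons] at hg
      rcases hg with rfl | rfl | hg
      · rfl
      · rfl
      · obtain ⟨ρ', h', -, rfl⟩ := mem_headH hg
        rfl
  have hP : ∀ {s m ps pm}, ∀ L ∈ phaseSlots s m ps pm d a ts, SlotOK L := slotOK_phaseSlots hl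
  have hR := fun g l => slotOK_rotSlots (Q := Q) g l
  refine forall_mem_append (hR _ _) <| forall_mem_append (hR _ _) <|
    forall_mem_append (hR _ _) <| forall_mem_append hL' <| forall_mem_append hP <|
    forall_mem_append (slotOK_invSlots hL) <| forall_mem_append (hR _ _) <|
    forall_mem_append hP <| forall_mem_append (hR _ _) <| forall_mem_append hL <|
    forall_mem_append (slotOK_invSlots hP) <| forall_mem_append (slotOK_invSlots hL) <|
    forall_mem_append (hR _ _) <| forall_mem_append (slotOK_invSlots hP) <|
    forall_mem_append ?_ <| forall_mem_append (hR _ _) (hR _ _)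
  intro L hL
  rw [List.mem_singleton.1 hL]
  exact slotOK_singleton _

theorem rotSlots_cost {Q : Type} [DecidableEq Q] {g : Q → Gate Q} (hg : ∀ q, (g q).kind = .rot)
    (l : List Q) (k : Kind) : slotsCost (rotSlots g l) k = if k = .rot then l.length else 0 := by
  induction l with
  | nil => simp [rotSlots]
  | cons q l ih =>
    rw [rotSlots, List.map_cons, ← rotSlots, slotsCost_cons, ih]
    by_cases h : k = .rot
    · simp [h, hg, add_comm]
    · simp [h, hg, Ne.symm h]

theorem rotSlots_depth {Q : Type} [DecidableEq Q] {g : Q → Gate Q} (hg : ∀ q, (g q).kind = .rot)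
    (l : List Q) {k : Kind} (hk : k ≠ .rot) : slotsDepth (rotSlots g l) k = 0 := by
  induction l with
  | nil => simp [rotSlots]
  | cons q l ih =>
    rw [rotSlots, List.map_cons, ← rotSlots, slotsDepth_cons, ih]
    simp [hg, hk.symm]

theorem phaseSlots_resources {s m a : Q} {ps pm : Fin 2} {d : ℕ} {ts : List Q}
    (hl : (a :: ts).Nodup) (hd : ts.length + 1 ≤ 2 ^ d) (hs : s ∉ a :: ts) (hm : m ∉ a :: ts) :
    slotsCost (phaseSlots s m ps pm d a ts) .rot = 0 ∧
    slotsCost (phaseSlots s m ps pm d a ts) .cnot = 2 * ts.length + 4 ∧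
    slotsDepth (phaseSlots s m ps pm d a ts) .cnot ≤ 2 * d + 4 ∧
    slotsCost (phaseSlots s m ps pm d a ts) .t = 4 ∧
    slotsDepth (phaseSlots s m ps pm d a ts) .t = 4 ∧
    slotsCost (phaseSlots s m ps pm d a ts) .h = 0 ∧
    slotsDepth (phaseSlots s m ps pm d a ts) .h = 0 := by
  have hsa : s ≠ a := by rintro rfl; simp at hs
  have hma : m ≠ a := by rintro rfl; simp at hm
  have h1 := fun k hk => fanSlots_cost_of_ne (d := d) hl (k := k) hk
  have h2 := fanSlots_cost hl hd
  have h3 := fanSlots_depth_le d (a :: ts)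
  simp only [phaseSlots, slotsCost_append, slotsDepth_append, slotsCost_invSlots,
    slotsDepth_invSlots, ccGates, List.map_append, List.map_cons, List.map_nil, slotsCost_cons,
    slotsDepth_cons, h2, (h1 .rot (by decide)).1, (h1 .t (by decide)).1, (h1 .t (by decide)).2,
    (h1 .h (by decide)).1, (h1 .h (by decide)).2]
  simp [kind_cx hsa, kind_cx hma]
  omega

theorem mainSlots_resources {ρ : Rung Q} {rs : List (Rung Q)} {s m y : Q} {d : ℕ} {a : Q}
    {ts : List Q} (α β φ : Q → ℝ) (hl : (a :: ts).Nodup) (hd : ts.length + 1 ≤ 2 ^ d)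
    (hρ : LadderOK (ρ :: rs)) (hs : s ∉ a :: ts) (hm : m ∉ a :: ts) (hy : y ∉ a :: ts) :
    slotsCost (mainSlots ρ rs s m y d a ts α β φ) .rot = 8 * ts.length + 3 ∧
    slotsCost (mainSlots ρ rs s m y d a ts α β φ) .cnot =
      12 * (rs.length + 1) + 16 + 8 * ts.length ∧
    slotsDepth (mainSlots ρ rs s m y d a ts α β φ) .cnot ≤ 8 * (rs.length + 1) + 20 + 8 * d ∧
    slotsCost (mainSlots ρ rs s m y d a ts α β φ) .t = 16 * (rs.length + 1) + 16 ∧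
    slotsDepth (mainSlots ρ rs s m y d a ts α β φ) .t = 8 * (rs.length + 1) + 24 ∧
    slotsCost (mainSlots ρ rs s m y d a ts α β φ) .h = 8 * (rs.length + 1) + 2 ∧
    slotsDepth (mainSlots ρ rs s m y d a ts α β φ) .h = 4 * (rs.length + 1) + 5 := by
  obtain ⟨a1, a2, a3, a4, a5, a6, a7⟩ :=
    phaseSlots_resources (ps := 1) (pm := 1) hl hd hs hm
  obtain ⟨b1, b2, b3, b4, b5, b6, b7⟩ :=
    phaseSlots_resources (ps := 0) (pm := 0) hl hd hs hy
  obtain ⟨c1, c2, c3, c4, c5, c6, c7⟩ :=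
    ladderSlots_resources (extra := []) hρ.valid (by simp)
  obtain ⟨d1, d2, d3, d4, d5, d6, d7⟩ :=
    ladderSlots_resources (extra := [.H a]) hρ.valid (by simp)
  have r1 : ∀ (f : Q → ℝ) l k, slotsCost (rotSlots (fun q => .Rx (f q) q) l) k =
      if k = .rot then l.length else 0 := fun f l k => rotSlots_cost (fun _ => rfl) l k
  have r2 : ∀ (f : Q → ℝ) l k, slotsCost (rotSlots (fun q => .Rz (f q) q) l) k =
      if k = .rot then l.length else 0 := fun f l k => rotSlots_cost (fun _ => rfl) l k
  have r3 : ∀ (f : Q → ℝ) l k, k ≠ .rot →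
      slotsDepth (rotSlots (fun q => .Rx (f q) q) l) k = 0 :=
    fun f l k hk => rotSlots_depth (fun _ => rfl) l hk
  have r4 : ∀ (f : Q → ℝ) l k, k ≠ .rot →
      slotsDepth (rotSlots (fun q => .Rz (f q) q) l) k = 0 :=
    fun f l k hk => rotSlots_depth (fun _ => rfl) l hk
  simp only [mainSlots, slotsCost_append, slotsDepth_append, slotsCost_invSlots,
    slotsDepth_invSlots, r1, r2, r3 _ _ .cnot (by decide), r3 _ _ .t (by decide),
    r3 _ _ .h (by decide), r4 _ _ .cnot (by decide), r4 _ _ .t (by decide),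
    r4 _ _ .h (by decide), a1, a2, a4, a5, a6, a7, b1, b2, b4, b5, b6, b7, c1, c2, c3, c4, c5,
    c6, c7, d1, d2, d3, d4, d5, d6, d7, slotsCost_cons, slotsDepth_cons, slotsCost_nil,
    slotsDepth_nil]
  simp
  omega

/-! ### Axis-angle decomposition in `SU(2)` -/

theorem exists_polar (u v : ℝ) :
    ∃ r θ : ℝ, 0 ≤ r ∧ r ^ 2 = u ^ 2 + v ^ 2 ∧ u = r * Real.cos θ ∧ v = r * Real.sin θ := by
  refine ⟨‖(⟨u, v⟩ : ℂ)‖, Complex.arg ⟨u, v⟩, norm_nonneg _, ?_, ?_, ?_⟩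
  · rw [Complex.sq_norm, Complex.normSq_mk]; ring
  · exact (Complex.norm_mul_cos_arg ⟨u, v⟩).symm
  · exact (Complex.norm_mul_sin_arg ⟨u, v⟩).symm

/-- Conjugating a rotation about the `x`-axis by `R_x(α) R_z(β)` yields the rotation by the same
angle about the axis with spherical coordinates `β` and `α`. -/
theorem rot_conj_eq (α β θ : ℝ) :
    rotX α * rotZ β * rotX (2 * θ) * rotZ (-β) * rotX (-α) =
      !![(Real.cos θ : ℂ) - Complex.I * (Real.sin θ * (Real.sin β * Real.sin α) : ℝ),
        -Complex.I * (Real.sin θ * Real.cos β : ℝ) - (Real.sin θ * (Real.sin β * Real.cos α) : ℝ);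
        -Complex.I * (Real.sin θ * Real.cos β : ℝ) + (Real.sin θ * (Real.sin β * Real.cos α) : ℝ),
        (Real.cos θ : ℂ) + Complex.I * (Real.sin θ * (Real.sin β * Real.sin α) : ℝ)] := by
  have e1 : ∀ φ : ℂ, Complex.exp (Complex.I * φ) =
      Complex.cos φ + Complex.sin φ * Complex.I := fun φ => by
    rw [mul_comm, Complex.exp_mul_I]
  have e2 : ∀ φ : ℂ, Complex.exp (-(Complex.I * φ)) =
      Complex.cos φ - Complex.sin φ * Complex.I := fun φ => by
    rw [mul_comm, ← neg_mul, Complex.exp_mul_I, Complex.cos_neg, Complex.sin_neg]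
    ring
  have a1 : Complex.cos α = Complex.cos (α / 2) ^ 2 - Complex.sin (α / 2) ^ 2 := by
    rw [← Complex.cos_two_mul']; congr 1; ring
  have a2 : Complex.sin α = 2 * Complex.sin (α / 2) * Complex.cos (α / 2) := by
    rw [← Complex.sin_two_mul]; congr 1; ring
  have b1 : Complex.cos β = Complex.cos (β / 2) ^ 2 - Complex.sin (β / 2) ^ 2 := by
    rw [← Complex.cos_two_mul']; congr 1; ring
  have b2 : Complex.sin β = 2 * Complex.sin (β / 2) * Complex.cos (β / 2) := by
    rw [← Complex.sin_two_mul]; congr 1; ring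
  have a3 := Complex.sin_sq_add_cos_sq (α / 2)
  have b3 := Complex.sin_sq_add_cos_sq (β / 2)
  have hI := Complex.I_sq
  ext i j
  fin_cases i <;> fin_cases j <;>
    simp [rotX, rotZ, Matrix.mul_apply, Fin.sum_univ_two, e1, e2, a1, a2, b1, b2, neg_div] <;>
    grind

/-- Every element of `SU(2)` is a rotation about an axis with suitable spherical coordinates. The
rotation angle is written as four times the angle that enters the commutator. -/
theorem exists_axis_angle {W : Matrix (Fin 2) (Fin 2) ℂ}
    (hW : W ∈ Matrix.specialUnitaryGroup (Fin 2) ℂ) :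
    ∃ α β θ : ℝ, W = rotX α * rotZ β * rotX (4 * θ) * rotZ (-β) * rotX (-α) := by
  obtain ⟨hU, hdet⟩ := Matrix.mem_specialUnitaryGroup_iff.1 hW
  have hadj : star W = W.adjugate := by
    have h1 : star W * W = 1 := Matrix.mem_unitaryGroup_iff'.1 hU
    have h2 : W * W.adjugate = 1 := by rw [Matrix.mul_adjugate, hdet, one_smul]
    calc star W = star W * (W * W.adjugate) := by rw [h2, mul_one]
      _ = W.adjugate := by rw [← mul_assoc, h1, one_mul]
  rw [Matrix.adjugate_fin_two] at hadj
  have h11 : W 1 1 = star (W 0 0) := by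
    have := congrFun (congrFun hadj 0) 0
    simpa [Matrix.star_apply] using this.symm
  have h10 : W 1 0 = -star (W 0 1) := by
    have := congrFun (congrFun hadj 1) 0
    simp [Matrix.star_apply] at this
    simp [this]
  have hn : (W 0 0).re ^ 2 + (W 0 0).im ^ 2 + (W 0 1).re ^ 2 + (W 0 1).im ^ 2 = 1 := by
    have := hdet
    rw [Matrix.det_fin_two, h11, h10] at this
    have := congrArg Complex.re this
    simp at this
    nlinarith
  obtain ⟨r, α, hr, hr2, h2, h3⟩ := exists_polar (-(W 0 1).re) (-(W 0 0).im)
  obtain ⟨s, β, hs, hs2, h1, hr'⟩ := exists_polar (-(W 0 1).im) r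
  obtain ⟨t, θ, ht, ht2, h0, hs'⟩ := exists_polar (W 0 0).re s
  have ht1 : t = 1 := by
    have : t ^ 2 = 1 := by rw [ht2, hs2, hr2]; linarith
    nlinarith
  subst ht1
  refine ⟨α, β, θ / 2, ?_⟩
  rw [show 4 * (θ / 2) = 2 * θ by ring, rot_conj_eq]
  rw [one_mul] at h0 hs'
  rw [← hs', ← h0, ← h1]
  have g2 : s * (Real.sin β * Real.cos α) = -(W 0 1).re := by rw [h2, hr']; ring
  have g3 : s * (Real.sin β * Real.sin α) = -(W 0 0).im := by rw [h3, hr']; ring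
  rw [g2, g3]
  ext i j
  fin_cases i <;> fin_cases j <;> apply Complex.ext <;> simp [h11, h10]

end

noncomputable section

/-! ### The register with an ancilla qubit -/

variable {Q : Type} [Fintype Q] [DecidableEq Q]

theorem smul_muxOp (f : Basis Q → ℂ) (F : Basis Q → Matrix (Fin 2) (Fin 2) ℂ) (t : Q) :
    muxOp (fun x => f x • F x) t = Matrix.diagonal f * muxOp F t := by
  ext x y
  rw [Matrix.diagonal_mul, muxOp_apply, muxOp_apply]
  split_ifs <;> simp

theorem muxOp_commute_diagonal {f : Basis Q → ℂ} {t : Q} (hf : IndepOf f t)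
    (F : Basis Q → Matrix (Fin 2) (Fin 2) ℂ) :
    Commute (muxOp F t) (Matrix.diagonal f) := by
  ext x y
  rw [Matrix.diagonal_mul, Matrix.mul_diagonal, muxOp_apply]
  split_ifs with h
  · rw [hf.eq_of_agree h, mul_comm]
  · simp

theorem indepOf_forall_mem {C : Finset Q} {t : Q} (ht : t ∉ C) {α : Type*} (a b : α) :
    IndepOf (fun x : Basis Q => if ∀ c ∈ C, x c = 1 then a else b) t := by
  intro x i
  have : (∀ c ∈ C, Function.update x t i c = 1) ↔ ∀ c ∈ C, x c = 1 :=
    forall₂_congr fun c hc => by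
      rw [Function.update_of_ne (ne_of_mem_of_not_mem hc ht)]
  simp only [this]

/-- The phases of the target operators of a multi-controlled multi-target gate accumulate on the
basis states in which all the controls are in state `1`. -/
theorem multiTarget_exp_smul {C : Finset Q} {m : ℕ} {t : Fin m → Q} (ht : ∀ j, t j ∉ C)
    {U W : Fin m → Matrix (Fin 2) (Fin 2) ℂ} {ψ : Fin m → ℝ}
    (h : ∀ j, U j = Complex.exp (Complex.I * (ψ j : ℂ)) • W j) :
    multiTarget C U t = Matrix.diagonal (fun x =>
      if ∀ c ∈ C, x c = 1 then Complex.exp (Complex.I * ((∑ j, ψ j : ℝ) : ℂ)) else 1) *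
        multiTarget C W t := by
  unfold multiTarget
  induction m with
  | zero => simp
  | succ m ih =>
    have e : controlled C (U 0) (t 0) = Matrix.diagonal (fun x =>
        if ∀ c ∈ C, x c = 1 then Complex.exp (Complex.I * (ψ 0 : ℂ)) else 1) *
          controlled C (W 0) (t 0) := by
      rw [controlled_eq_muxOp, controlled_eq_muxOp, ← smul_muxOp, h 0]
      congr 1
      funext x
      split_ifs <;> simp
    have hc := muxOp_commute_diagonal (indepOf_forall_mem (ht 0)
      (Complex.exp (Complex.I * ((∑ j : Fin m, ψ j.succ : ℝ) : ℂ))) 1)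
        (fun x => if ∀ c ∈ C, x c = 1 then W 0 else 1)
    rw [← controlled_eq_muxOp] at hc
    rw [List.ofFn_succ, List.ofFn_succ, List.prod_cons, List.prod_cons,
      ih (fun j => ht j.succ) (fun j => h j.succ), e, mul_assoc, ← mul_assoc (controlled _ _ _),
      hc.eq, mul_assoc, ← mul_assoc, Matrix.diagonal_mul_diagonal]
    congr 2
    funext x
    split_ifs
    · rw [← Complex.exp_add, Fin.sum_univ_succ]
      push_cast
      ring_nf
    · simp

variable {n m : ℕ}

theorem forall_mem_fullControls {p : FullReg n m → Prop} :
    (∀ c ∈ fullControls n m, p c) ↔ ∀ i, p (Sum.inl (Sum.inl i)) := by simp [fullControls]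

theorem forall_mem_dataControls {p : DataReg n m → Prop} :
    (∀ c ∈ dataControls n m, p c) ↔ ∀ i, p (Sum.inl i) := by simp [dataControls]

theorem controlled_mulVec_withAncilla (A : Matrix (Fin 2) (Fin 2) ℂ) (t : DataReg n m)
    (φ : State (DataReg n m)) :
    (controlled (fullControls n m) A (Sum.inl t)).mulVec (withAncilla φ) =
      withAncilla ((controlled (dataControls n m) A t).mulVec φ) := by
  funext x
  rw [controlled_eq_muxOp, controlled_eq_muxOp, muxOp_mulVec]
  have hu : ∀ b, (fun q => Function.update x (Sum.inl t) b (Sum.inl q)) =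
      Function.update (fun q => x (Sum.inl q)) t b := fun b =>
    Function.update_comp_eq_of_injective x Sum.inl_injective t b
  have ha : ∀ b, Function.update x (Sum.inl t) b (ancilla n m) = x (ancilla n m) := fun b =>
    Function.update_of_ne (by simp [ancilla]) _ _
  simp only [withAncilla, hu, ha, muxOp_mulVec, forall_mem_fullControls, forall_mem_dataControls]
  split_ifs <;> simp

/-- Gates on controls and targets leave the ancilla qubit in state `0`. -/
theorem multiTarget_mulVec_withAncilla (W : Fin m → Matrix (Fin 2) (Fin 2) ℂ)
    (φ : State (DataReg n m)) :
    (multiTarget (fullControls n m) W fun j => Sum.inl (Sum.inr j)).mulVec (withAncilla φ) =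
      withAncilla ((multiTarget (dataControls n m) W fun j => Sum.inr j).mulVec φ) := by
  simp only [multiTarget, List.ofFn_eq_map]
  induction List.finRange m with
  | nil => simp
  | cons j l ih =>
    rw [List.map_cons, List.map_cons, List.prod_cons, List.prod_cons, ← Matrix.mulVec_mulVec, ih,
      controlled_mulVec_withAncilla, Matrix.mulVec_mulVec]

theorem muxOp_rotZ_mulVec_withAncilla (θ : ℝ) (p : Basis (FullReg n m) → Prop) [DecidablePred p]
    (φ : State (DataReg n m)) :
    (muxOp (fun x => if p x then rotZ θ else 1) (ancilla n m)).mulVec (withAncilla φ) =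
      fun x => (if p x then Complex.exp (-(Complex.I * (θ / 2))) else 1) * withAncilla φ x := by
  funext x
  have hu : ∀ b, (fun q : DataReg n m =>
      Function.update x (ancilla n m) b (Sum.inl q)) = fun q => x (Sum.inl q) := fun b => by
    funext q
    exact Function.update_of_ne (by simp [ancilla]) _ _
  rw [muxOp_mulVec, Fin.sum_univ_two]
  simp only [withAncilla, hu, Function.update_self, if_true, one_ne_zero, if_false, mul_zero,
    add_zero]
  rcases (show x (ancilla n m) = 0 ∨ x (ancilla n m) = 1 by omega) with h | h <;>
    split_ifs with h1 <;> simp_all [rotZ, Matrix.one_apply]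

/-- In the subspace in which the ancilla qubit is in state `0`, the controlled `Z` rotation of the
ancilla qubit multiplies the basis states with all controls in state `1` by a phase. -/
theorem controlled_ancilla_mul_multiTarget_mulVec {U W : Fin m → Matrix (Fin 2) (Fin 2) ℂ}
    {ψ : Fin m → ℝ} (h : ∀ j, U j = Complex.exp (Complex.I * (ψ j : ℂ)) • W j)
    (φ : State (DataReg n m)) :
    (controlled (fullControls n m) (rotZ (-2 * ∑ j, ψ j)) (ancilla n m) *
        multiTarget (fullControls n m) W (fun j => Sum.inl (Sum.inr j))).mulVec (withAncilla φ) =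
      withAncilla ((multiTarget (dataControls n m) U (fun j => Sum.inr j)).mulVec φ) := by
  have ht : ∀ j : Fin m, (Sum.inr j : DataReg n m) ∉ dataControls n m := by simp [dataControls]
  rw [← Matrix.mulVec_mulVec, multiTarget_mulVec_withAncilla, controlled_eq_muxOp,
    muxOp_rotZ_mulVec_withAncilla, multiTarget_exp_smul ht h, ← Matrix.mulVec_mulVec]
  funext x
  simp only [withAncilla, Matrix.mulVec_diagonal, forall_mem_fullControls, forall_mem_dataControls]
  split_ifs
  · congr 2
    push_cast
    ring
  all_goals simp

/-- The phase is half the argument of the determinant. -/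
theorem exists_phase_smul_mem_specialUnitaryGroup {U : Matrix (Fin 2) (Fin 2) ℂ}
    (hU : U ∈ Matrix.unitaryGroup (Fin 2) ℂ) :
    ∃ (ψ : ℝ) (W : Matrix (Fin 2) (Fin 2) ℂ), W ∈ Matrix.specialUnitaryGroup (Fin 2) ℂ ∧
      U = Complex.exp (Complex.I * (ψ : ℂ)) • W := by
  have hd : ‖U.det‖ = 1 := by
    have := Matrix.det_of_mem_unitary hU
    exact CStarRing.norm_of_mem_unitary this
  obtain ⟨δ, hδ⟩ := (Complex.norm_eq_one_iff _).1 hd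
  have e : Complex.exp (Complex.I * ((δ / 2 : ℝ) : ℂ)) *
      Complex.exp (-(Complex.I * ((δ / 2 : ℝ) : ℂ))) = 1 := by
    rw [← Complex.exp_add, add_neg_cancel, Complex.exp_zero]
  refine ⟨δ / 2, Complex.exp (-(Complex.I * ((δ / 2 : ℝ) : ℂ))) • U, ?_, ?_⟩
  · rw [Matrix.mem_specialUnitaryGroup_iff]
    constructor
    · rw [Matrix.mem_unitaryGroup_iff] at hU ⊢
      have hs : star (Complex.exp (-(Complex.I * ((δ / 2 : ℝ) : ℂ)))) =
          Complex.exp (Complex.I * ((δ / 2 : ℝ) : ℂ)) := by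
        rw [Complex.star_def, ← Complex.exp_conj, map_neg, map_mul, Complex.conj_I,
          Complex.conj_ofReal, neg_mul, neg_neg]
      rw [star_smul, hs, smul_mul_smul_comm, hU, mul_comm, e, one_smul]
    · rw [Matrix.det_smul, ← hδ, Fintype.card_fin, ← Complex.exp_nat_mul, ← Complex.exp_add,
        ← Complex.exp_zero]
      congr 1
      push_cast
      ring
  · rw [smul_smul, e, one_smul]


/-! ### The circuit on the register with an ancilla qubit -/

/-- The controls, numbered by the natural numbers modulo `n`. -/
def wire (n m : ℕ) [NeZero n] (i : ℕ) : FullReg n m := Sum.inl (Sum.inl (Fin.ofNat n i))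

theorem wire_ne [NeZero n] : ∀ i < n, ∀ j < n, i ≠ j → wire n m i ≠ wire n m j := by
  intro i hi j hj hij h
  simp only [wire, Sum.inl.injEq, Fin.ext_iff, Fin.val_ofNat, Nat.mod_eq_of_lt hi,
    Nat.mod_eq_of_lt hj] at h
  exact hij h

theorem forall_wire [NeZero n] {p : FullReg n m → Prop} :
    (∀ i < n, p (wire n m i)) ↔ ∀ c ∈ fullControls n m, p c := by
  rw [forall_mem_fullControls]
  constructor
  · intro h i
    simpa [wire] using h i i.2
  · exact fun h i _ => h _

/-- The target qubits. -/
def targets (n m : ℕ) : List (FullReg n m) := (List.finRange m).map fun j => Sum.inl (Sum.inr j)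

theorem length_targets : (targets n m).length = m := by simp [targets]

theorem nodup_ancilla_targets : (ancilla n m :: targets n m).Nodup := by
  rw [List.nodup_cons]
  constructor
  · simp [targets, ancilla]
  · exact (List.nodup_finRange m).map (Sum.inl_injective.comp Sum.inr_injective)

theorem wire_notMem [NeZero n] (i : ℕ) : wire n m i ∉ ancilla n m :: targets n m := by
  simp [wire, targets, ancilla]

/-- Angles on the whole register, from angles for the targets and for the ancilla qubit; the value on
the controls is irrelevant. -/
def angles (θ : Fin m → ℝ) (θ₀ : ℝ) : FullReg n m → ℝ :=
  Sum.elim (Sum.elim (fun _ => 0) θ) fun _ => θ₀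

theorem mtOp_eq_controlled_mul_multiTarget {C : Finset (FullReg n m)}
    (p : Basis (FullReg n m) → Prop) [DecidablePred p] (hp : ∀ x, p x ↔ ∀ c ∈ C, x c = 1)
    (W : FullReg n m → Matrix (Fin 2) (Fin 2) ℂ) :
    mtOp (fun q x => if p x then W q else 1) (ancilla n m :: targets n m) =
      controlled C (W (ancilla n m)) (ancilla n m) *
        multiTarget C (fun j => W (Sum.inl (Sum.inr j))) fun j => Sum.inl (Sum.inr j) := by
  rw [mtOp_cons, mtOp, targets, List.map_map, multiTarget, List.ofFn_eq_map]
  simp only [Function.comp_def, controlled_eq_muxOp, hp]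

theorem mtOp_ancilla_mulVec_withAncilla (θ : FullReg n m → ℝ) (φ : State (DataReg n m)) :
    (mtOp (fun q _ => if q = ancilla n m then rotZ (θ q) else 1)
        (ancilla n m :: targets n m)).mulVec (withAncilla φ) =
      Complex.exp (-(Complex.I * (θ (ancilla n m) / 2))) • withAncilla φ := by
  have h : mtOp (fun q _ => if q = ancilla n m then rotZ (θ q) else 1) (targets n m) = 1 := by
    rw [← mtOp_one (targets n m), mtOp, mtOp]
    congr 1
    refine List.map_congr_left fun q hq => ?_
    rw [if_neg (ne_of_mem_of_not_mem hq (List.nodup_cons.1 nodup_ancilla_targets).1)]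
  rw [mtOp_cons, h, mul_one]
  have := muxOp_rotZ_mulVec_withAncilla (θ (ancilla n m)) (fun _ => True) φ
  simp only [if_true] at this ⊢
  rw [this]
  rfl

/-- The circuit for the gate, before its time slots are split. -/
theorem exists_slots (hn : 6 ≤ n) {U W : Fin m → Matrix (Fin 2) (Fin 2) ℂ} {ψ : Fin m → ℝ}
    (hW : ∀ j, W j ∈ Matrix.specialUnitaryGroup (Fin 2) ℂ)
    (hU : ∀ j, U j = Complex.exp (Complex.I * (ψ j : ℂ)) • W j) :
    ∃ s : List (List (Gate (FullReg n m))), (∀ L ∈ s, SlotOK L) ∧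
      (∃ ω : ℂ, ‖ω‖ = 1 ∧ ∀ φ : State (DataReg n m),
        (gatesOp s.flatten).mulVec (withAncilla φ) = ω • withAncilla
          ((multiTarget (dataControls n m) U (fun j => Sum.inr j)).mulVec φ)) ∧
      slotsCost s .rot = 8 * m + 3 ∧
      slotsCost s .cnot = 12 * n - 32 + 8 * m ∧
      slotsDepth s .cnot ≤ 8 * n - 12 + 8 * Nat.clog 2 (m + 1) ∧
      slotsCost s .t = 16 * n - 48 ∧ slotsDepth s .t = 8 * n - 8 ∧
      slotsCost s .h = 8 * n - 30 ∧ slotsDepth s .h = 4 * n - 11 := by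
  have : NeZero n := ⟨by omega⟩
  choose α β θ hθ using fun j => exists_axis_angle (hW j)
  have hlen := ladder_length (c := wire n m) hn
  have hok := ladderOK_ladder hn (wire_ne (n := n) (m := m))
  have hact := fun x => ladder_act (x := x) hn (wire_ne (n := n) (m := m))
  have hmem := fun ρ => ladder_mem (c := wire n m) (n := n) (ρ := ρ)
  obtain ⟨k, hy⟩ := ladderOut_mem (wire n m) n
  have hy : ladderOut (wire n m) n ∉ ancilla n m :: targets n m := hy ▸ wire_notMem k
  generalize ladder (wire n m) n = l at hlen hok hact hmem
  obtain _ | ⟨ρ, rs⟩ := l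
  · simp at hlen; omega
  rw [List.length_cons] at hlen
  have hr : ∀ t ∈ ancilla n m :: targets n m, ∀ ρ' ∈ ρ :: rs,
      t ≠ ρ'.tgt ∧ t ≠ ρ'.mid ∧ t ≠ ρ'.side := by
    intro t ht ρ' hρ'
    obtain ⟨i, j, k, h1, h2, h3⟩ := hmem ρ' hρ'
    rw [h1, h2, h3]
    refine ⟨?_, ?_, ?_⟩ <;> exact ne_of_mem_of_not_mem ht (wire_notMem _)
  have hd : (targets n m).length + 1 ≤ 2 ^ Nat.clog 2 (m + 1) := by
    rw [length_targets]
    exact Nat.le_pow_clog (by norm_num) _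
  have hs := wire_notMem (n := n) (m := m) 0
  have hm := wire_notMem (n := n) (m := m) 1
  -- four times the angle of the ancilla qubit is `-2 * ∑ j, ψ j`
  set φ₀ : ℝ := -(∑ j, ψ j) / 2 with hφ₀
  refine ⟨mainSlots ρ rs (wire n m 0) (wire n m 1) (ladderOut (wire n m) n)
    (Nat.clog 2 (m + 1)) (ancilla n m) (targets n m) (angles α 0) (angles β 0) (angles θ φ₀),
    slotOK_mainSlots _ _ _ nodup_ancilla_targets hok fun ρ' h' => (hr _ (by simp) ρ' h').1,
    ⟨Complex.exp (-(Complex.I * ((-φ₀ : ℝ) / 2))), ?_, fun φ => ?_⟩, ?_⟩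
  · rw [show -(Complex.I * (((-φ₀ : ℝ) : ℂ) / 2)) = ((φ₀ / 2 : ℝ) : ℂ) * Complex.I by
      push_cast; ring]
    exact Complex.norm_exp_ofReal_mul_I _
  · rw [gatesOp_mainSlots _ _ _ nodup_ancilla_targets hd hok hr hs hm hy,
      mtOp_eq_controlled_mul_multiTarget (C := fullControls n m) (p := fun x =>
        (x (wire n m 0) = 1 ∧ x (wire n m 1) = 1) ∧ (actList (ρ :: rs) x (wire n m 0) = 0 ∧
          actList (ρ :: rs) x (ladderOut (wire n m) n) = 0)) (W := fun q =>
        if q = ancilla n m then rotZ (4 * angles θ φ₀ q) else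
          rotX (angles α 0 q) * rotZ (angles β 0 q) * rotX (4 * angles θ φ₀ q) *
            rotZ (-angles β 0 q) * rotX (-angles α 0 q)),
      ← Matrix.mulVec_mulVec, mtOp_ancilla_mulVec_withAncilla fun q => -angles θ φ₀ q,
      Matrix.mulVec_smul]
    · congr 1
      rw [← controlled_ancilla_mul_multiTarget_mulVec hU]
      congr 3
      · rw [if_pos rfl]
        congr 1
        simp only [angles, ancilla, Sum.elim_inr, hφ₀]
        ring
      · funext j
        rw [if_neg (by simp [ancilla]), hθ j]
        rfl
    -- the two conditions of the commutator together say that all controls are in state `1`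
    · intro x
      rw [← forall_wire (p := fun c => x c = 1)]
      constructor
      · rintro ⟨⟨h0, h1⟩, h⟩
        exact (hact x h0 h1).1 h
      · intro h
        have h0 := h 0 (by omega)
        have h1 := h 1 (by omega)
        exact ⟨⟨h0, h1⟩, (hact x h0 h1).2 h⟩
  · obtain ⟨r1, r2, r3, r4, r5, r6, r7⟩ := mainSlots_resources (angles α 0) (angles β 0)
      (angles θ φ₀) nodup_ancilla_targets hd hok hs hm hy
    rw [hlen] at r2 r3 r4 r5 r6 r7
    rw [length_targets] at r1 r2
    refine ⟨?_, ?_, ?_, ?_, ?_, ?_, ?_⟩ <;> omega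

end

end QCircuit

theorem mainTheorem3 (n m : ℕ) (hn : 6 ≤ n) (hm : 1 ≤ m)
    (U : Fin m → Matrix (Fin 2) (Fin 2) ℂ)
    (hU : ∀ j, U j ∈ Matrix.unitaryGroup (Fin 2) ℂ) :
    -- every target operator is a phase times an element of `SU(2)`
    (∃ (ψ : Fin m → ℝ) (W : Fin m → Matrix (Fin 2) (Fin 2) ℂ), ∀ j,
      W j ∈ Matrix.specialUnitaryGroup (Fin 2) ℂ ∧
        U j = Complex.exp (Complex.I * (ψ j : ℂ)) • W j) ∧
    -- for every such choice, the phases are absorbed by a controlled rotation of the ancilla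
    (∀ (ψ : Fin m → ℝ) (W : Fin m → Matrix (Fin 2) (Fin 2) ℂ),
      (∀ j, W j ∈ Matrix.specialUnitaryGroup (Fin 2) ℂ ∧
        U j = Complex.exp (Complex.I * (ψ j : ℂ)) • W j) →
      ∀ φ : State (DataReg n m),
        (controlled (fullControls n m) (rotZ (-2 * ∑ j, ψ j)) (ancilla n m) *
            multiTarget (fullControls n m) W (fun j => Sum.inl (Sum.inr j))).mulVec
          (withAncilla φ) =
        withAncilla ((multiTarget (dataControls n m) U (fun j => Sum.inr j)).mulVec φ)) ∧
    -- a circuit with one clean ancilla implements the gate, up to a global phase `ω`,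
    -- with the stated costs and depths
    (∃ V : Circuit (FullReg n m),
      (∃ ω : ℂ, ‖ω‖ = 1 ∧ ∀ φ : State (DataReg n m),
        V.op.mulVec (withAncilla φ) =
          ω • withAncilla
            ((multiTarget (dataControls n m) U (fun j => Sum.inr j)).mulVec φ)) ∧
      V.resources = mcmtu2Resources n m) := by
  choose ψ W hW using fun j => exists_phase_smul_mem_specialUnitaryGroup (hU j)
  refine ⟨⟨ψ, W, hW⟩, fun ψ W h φ =>
    controlled_ancilla_mul_multiTarget_mulVec (fun j => (h j).2) φ, ?_⟩
  obtain ⟨s, hs, hop, r1, r2, r3, r4, r5, r6, r7⟩ :=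
    exists_slots hn (fun j => (hW j).1) fun j => (hW j).2
  have hclog : Nat.clog 2 (m + 1) ≤ m := Nat.clog_le_of_le_pow (Nat.lt_two_pow_self)
  -- the circuit is shallower than required; gates that share a time slot are run one by one
  obtain ⟨s₁, hs₁, hf₁, hd₁, he₁⟩ := exists_slots_depth_eq hs
    (k := .cnot) (d := 8 * n - 8 + 8 * Nat.clog 2 (m + 1)) (by omega) (by omega)
  have c₁ : ∀ k, slotsCost s₁ k = slotsCost s k := fun k => by rw [slotsCost, hf₁, slotsCost]
  obtain ⟨s₂, hs₂, hf₂, hd₂, he₂⟩ := exists_slots_depth_eq hs₁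
    (k := .t) (d := if Even n then 8 * n - 6 else 8 * n - 3)
    (by rw [he₁ _ (by decide)]; split_ifs <;> omega) (by rw [c₁]; split_ifs <;> omega)
  have c₂ : ∀ k, slotsCost s₂ k = slotsCost s k := fun k => by
    rw [slotsCost, hf₂, ← c₁, slotsCost]
  refine ⟨⟨s₂, fun L hL => (hs₂ L hL).1⟩, ?_, ?_⟩
  · rw [← hf₁, ← hf₂] at hop
    exact hop
  · change Resources.mk (slotsCost s₂ .rot) (slotsCost s₂ .cnot) (slotsDepth s₂ .cnot)
      (slotsCost s₂ .t) (slotsDepth s₂ .t) (slotsCost s₂ .h) (slotsDepth s₂ .h) = _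
    rw [c₂, c₂, c₂, c₂, he₂ .cnot (by decide), hd₁, hd₂, he₂ .h (by decide), he₁ .h (by decide),
      r1, r2, r4, r6, r7]
    simp only [mcmtu2Resources, mcmtsu2Resources, mcsu2Resources, Resources.mk.injEq,
      true_and, and_true]
    refine ⟨?_, ?_, ?_⟩ <;> omega
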